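/- **Setting.** Let $X=\mathbb R\times[0,1]^{\mathbb N}$ with Lebesgue measure, $\rho:[0,1]^2\to[0,1]$ a measure-preserving Borel isomorphism, $\Omega$ a monoid of weights and $m:\Omega\to[0,\infty]$ a map. Write $(a,s,e)$ for the points of $X\times[0,1]$ and $x\bullet s$ for concatenation. The microcosm $\mathfrak{ll}_\rho$ is the monoid of maps $X\times[0,1]\to X\times[0,1]$ generated by $(x,s,e)\mapsto(\alpha x+\lambda,s,e)$ with $\alpha\neq0$, the finite permutations of the coordinates of $s$, the map $(a,(x,y)\bullet s,e)\mapsto(a,\rho(x,y)\bullet s,e)$ and its inverse, and the exchange $(a,x\bullet s,e)\mapsto(a,e\bullet s,x)$. A graphing $G$ of measurable support $S\subset X$ and dialect $[0,1]$ is a family of edges $e$, each with a measurable source $s(e)\subset S\times[0,1]$, a realiser $\phi_e$ (a Borel automorphism of $X\times[0,1]$) with $\phi_e(s(e))\subset S\times[0,1]$, and a weight $\omega(e)\in\Omega$. It is an $\mathfrak{ll}_\rho$-graphing if all $\phi_e\in\mathfrak{ll}_\rho$. A product of dialects is identified with $[0,1]$ through $\rho$; $G\times\mathrm{Id}$ denotes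 $G$ with an additional, unused, dialect component, i.e. with realisers $\phi_e\times\mathrm{Id}_{[0,1]}$. Graphings are compared up to renaming of edges and negligible sets. The execution $F\mathbin{::}G$ has support $S^F\mathbin\Delta S^G$ and dialect the product of the dialects (an edge of one graphing leaves the dialect of the other unchanged); its edges are the alternating paths between $F$ and $G$, restricted to the points that start and end outside $S^F\cap S^G$. The measurement is $$[\![F,G]\!]=\sum_{\pi}\int_{\operatorname{supp}\pi}\frac{m(\omega(\pi)^{r_\pi(x)})}{r_\pi(x)}\,dx ,$$ over the alternating circuits $\pi$ that are not proper powers, up to cyclic permutation (each class contributing the mean over its rooted representatives), where $\operatorname{supp}\pi$ is the set of points of finite orbit under the partial map $\phi_\pi$ and $r_\pi(x)$ is the length of the orbit. A project is $\mathfrak a=(a,A)$ with $a\in[0,\infty]$ and $A=\sum_i\alpha_iA_i$ a finite formal sum of graphings of the same support with $\alpha_i\in\mathbb R$; execution and measurement extend to formal sums by bilinearity. Put $1_A=\sum_i\alpha_i$, $\langle\mathfrak a,\mathfrak b\rangle=a1_B+b1_A+[\![A,B]\!]$ and $\mathfrak a\mathbin{::}\mathfrak b=(\langle\mathfrak a,\mathfrak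 b\rangle,A\mathbin{::}B)$. Projects of equal support are orthogonal if $\langle\mathfrak a,\mathfrak b\rangle$ is finite and non-zero; a conduct of support $V$ is a set $\mathbf A=\mathbf A^{\perp\perp}$ of $\mathfrak{ll}_\rho$-projects of support $V$. For $\mathbf A,\mathbf B$ of disjoint supports $V,W$, $\mathbf A\multimap\mathbf B$ is the set of $\mathfrak{ll}_\rho$-projects $\mathfrak f$ of support $V\cup W$ such that, for all $\mathfrak a\in\mathbf A$, $\mathfrak f\mathbin{::}\mathfrak a$ is a project (that is, $\langle\mathfrak f,\mathfrak a\rangle\in[0,\infty]$) and lies in $\mathbf B$. A project is balanced if its wager $a$ is $0$ and $A$ is a single graphing (with coefficient $1$). It is winning if it is balanced, each edge $e$ has a reverse edge (source $\phi_e(s(e))$, realiser $\phi_e^{-1}$), and the sources of distinct edges are disjoint. For $\mathfrak a=(0,A)$ balanced, $!\mathfrak a=(0,!A)$, where $!A$ has an edge $(a,(d,y)\bullet s,e)\mapsto(a',(d',y)\bullet s',e)$, of the same weight, for each edge $(a,s,d)\mapsto(a',s',d')$ of $A$; $!V=\{(a,(d,y)\bullet s):(a,s)\in V\}$, and $!\mathbf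 A=\{!\mathfrak a:\mathfrak a\in\mathbf A\text{ balanced}\}^{\perp\perp}$, of support $!V$. For a Borel automorphism $B$ of $X\times[0,1]$, $B(G)$ has the realisers $B\phi_eB^{-1}$ with sources $B(s(e))$; a Borel automorphism $\theta$ of $X$ acts as $\theta\times\mathrm{Id}_{[0,1]}$. Let $$\mathrm{raise}:(a,(x,y)\bullet s,e)\mapsto(a,s,\rho(x,\rho(y,e))).$$ **Theorem (dereliction).** The map $\mathrm{raise}$ belongs to $\mathfrak{ll}_\rho$. Let $\mathbf A$ be a conduct of measurable support $V$ and let $\theta$ be a measure-preserving Borel automorphism of $X$ with $\theta\times\mathrm{Id}_{[0,1]}\in\mathfrak{ll}_\rho$ and $!V\cap\theta(V)=\emptyset$. Denote by $\theta(\mathbf A)=\{\theta(\mathfrak a):\mathfrak a\in\mathbf A\}^{\perp\perp}$ the copy of $\mathbf A$ on $\theta(V)$. Then there is a winning project $\mathfrak{der}_{\mathbf A}\in{!\mathbf A}\multimap\theta(\mathbf A)$ such that, for every balanced $\mathfrak a=(0,A)\in\mathbf A$, $$\mathfrak{der}_{\mathbf A}\mathbin{::}{!\mathfrak a}=\bigl(0,\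 \theta(\mathrm{raise}(!A))\times\mathrm{Id}\bigr)\qquad\text{and}\qquad \mathrm{raise}(!A)=A\times\mathrm{Id}.$$ That is, $\mathfrak{der}_{\mathbf A}\mathbin{::}{!\mathfrak a}$ is $(0,\mathrm{raise}(!A))$, which is $\mathfrak a$, relocated by $\theta$ and up to unused dialect components. -/

import Mathlib

open MeasureTheory Set
open scoped ENNReal unitInterval

namespace InteractionGraphs

noncomputable section

/-! ### The space -/

/-- Sequences in `[0,1]`: the Hilbert cube. -/
abbrev Cube : Type := ℕ → I

/-- The space `X = ℝ × [0,1]^ℕ`. -/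
abbrev Pt : Type := ℝ × Cube

/-- Lebesgue measure on `X`. -/
def muX : Measure Pt :=
  (volume : Measure ℝ).prod (Measure.infinitePi fun _ : ℕ => (volume : Measure I))

/-- The measure on `X × [0,1]`; the factor `[0,1]` is the dialect. -/
def muXI : Measure (Pt × I) := muX.prod (volume : Measure I)

/-- Concatenation `x • s`. -/
def consSeq (x : I) (s : Cube) : Cube := fun n => Nat.casesOn n x s

/-- `x • s ↦ s`. -/
def tailSeq (s : Cube) : Cube := fun n => s (n + 1)

lemma consSeq_tailSeq (s : Cube) : consSeq (s 0) (tailSeq s) = s := by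
  funext n; cases n <;> rfl

lemma measurable_consSeq : Measurable fun p : I × Cube => consSeq p.1 p.2 := by
  refine measurable_pi_iff.2 fun n => ?_
  cases n with
  | zero => exact measurable_fst
  | succ n => exact (measurable_pi_apply n).comp measurable_snd

lemma measurable_tailSeq : Measurable tailSeq :=
  measurable_pi_iff.2 fun n => measurable_pi_apply (n + 1)

/-! ### The microcosm -/

/-- The affine map `(x, s, e) ↦ (α x + l, s, e)`. -/
def affineMap (α l : ℝ) (hα : α ≠ 0) : Pt × I ≃ᵐ Pt × I where
  toFun p := ((α * p.1.1 + l, p.1.2), p.2)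
  invFun p := ((α⁻¹ * (p.1.1 - l), p.1.2), p.2)
  left_inv p := by
    refine Prod.ext (Prod.ext ?_ rfl) rfl
    simp [hα]
  right_inv p := by
    refine Prod.ext (Prod.ext ?_ rfl) rfl
    simp [hα]
  measurable_toFun := by
    change Measurable fun p : Pt × I => (((α * p.1.1 + l, p.1.2), p.2) : Pt × I)
    fun_prop
  measurable_invFun := by
    change Measurable fun p : Pt × I => (((α⁻¹ * (p.1.1 - l), p.1.2), p.2) : Pt × I)
    fun_prop

/-- The map `(x, s, e) ↦ (x, τ(s), e)` permuting the coordinates of the Hilbert cube. -/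
def permMap (τ : Equiv.Perm ℕ) : Pt × I ≃ᵐ Pt × I where
  toFun p := ((p.1.1, fun n => p.1.2 (τ n)), p.2)
  invFun p := ((p.1.1, fun n => p.1.2 (τ.symm n)), p.2)
  left_inv p := by
    refine Prod.ext (Prod.ext rfl ?_) rfl
    funext n; simp
  right_inv p := by
    refine Prod.ext (Prod.ext rfl ?_) rfl
    funext n; simp
  measurable_toFun := by
    change Measurable fun p : Pt × I => (((p.1.1, fun n => p.1.2 (τ n)), p.2) : Pt × I)
    fun_prop
  measurable_invFun := by
    change Measurable fun p : Pt × I => (((p.1.1, fun n => p.1.2 (τ.symm n)), p.2) : Pt × I)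
    fun_prop

/-- The map `(a, (x, y) • s, e) ↦ (a, ρ(x, y) • s, e)`. -/
def rhoMap (ρ : I × I ≃ᵐ I) : Pt × I ≃ᵐ Pt × I where
  toFun p := ((p.1.1, consSeq (ρ (p.1.2 0, p.1.2 1)) (tailSeq (tailSeq p.1.2))), p.2)
  invFun p := ((p.1.1,
    consSeq (ρ.symm (p.1.2 0)).1 (consSeq (ρ.symm (p.1.2 0)).2 (tailSeq p.1.2))), p.2)
  left_inv p := by
    refine Prod.ext (Prod.ext rfl ?_) rfl
    funext n
    rcases n with _ | _ | n <;> simp [consSeq, tailSeq]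
  right_inv p := by
    refine Prod.ext (Prod.ext rfl ?_) rfl
    funext n
    rcases n with _ | n <;> simp [consSeq, tailSeq]
  measurable_toFun := by
    have h : Measurable fun p : Pt × I => ρ (p.1.2 0, p.1.2 1) :=
      ρ.measurable.comp (by fun_prop)
    have ht : Measurable fun p : Pt × I => tailSeq (tailSeq p.1.2) :=
      measurable_tailSeq.comp (measurable_tailSeq.comp (by fun_prop))
    exact ((measurable_fst.comp measurable_fst).prodMk
      (measurable_consSeq.comp (h.prodMk ht))).prodMk measurable_snd
  measurable_invFun := by
    have h : Measurable fun p : Pt × I => ρ.symm (p.1.2 0) :=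
      ρ.symm.measurable.comp (by fun_prop)
    have ht : Measurable fun p : Pt × I => tailSeq p.1.2 :=
      measurable_tailSeq.comp (by fun_prop)
    exact ((measurable_fst.comp measurable_fst).prodMk
      (measurable_consSeq.comp ((measurable_fst.comp h).prodMk
        (measurable_consSeq.comp ((measurable_snd.comp h).prodMk ht))))).prodMk measurable_snd

/-- The exchange `(a, x • s, e) ↦ (a, e • s, x)`. -/
def xch : Pt × I ≃ᵐ Pt × I where
  toFun p := ((p.1.1, consSeq p.2 (tailSeq p.1.2)), p.1.2 0)
  invFun p := ((p.1.1, consSeq p.2 (tailSeq p.1.2)), p.1.2 0)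
  left_inv p := Prod.ext (Prod.ext rfl (consSeq_tailSeq p.1.2)) rfl
  right_inv p := Prod.ext (Prod.ext rfl (consSeq_tailSeq p.1.2)) rfl
  measurable_toFun := by
    have ht : Measurable fun p : Pt × I => tailSeq p.1.2 :=
      measurable_tailSeq.comp (by fun_prop)
    exact ((measurable_fst.comp measurable_fst).prodMk
      (measurable_consSeq.comp (measurable_snd.prodMk ht))).prodMk (by fun_prop)
  measurable_invFun := by
    have ht : Measurable fun p : Pt × I => tailSeq p.1.2 :=
      measurable_tailSeq.comp (by fun_prop)
    exact ((measurable_fst.comp measurable_fst).prodMk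
      (measurable_consSeq.comp (measurable_snd.prodMk ht))).prodMk (by fun_prop)

/-- The microcosm: the monoid of maps `X × [0,1] → X × [0,1]` generated by the (invertible) affine
maps, the finite permutations, the map `rhoMap ρ` and its inverse, and the exchange. -/
inductive Microcosm (ρ : I × I ≃ᵐ I) : (Pt × I ≃ᵐ Pt × I) → Prop
  | one : Microcosm ρ (MeasurableEquiv.refl _)
  | comp {φ ψ : Pt × I ≃ᵐ Pt × I} : Microcosm ρ φ → Microcosm ρ ψ → Microcosm ρ (φ.trans ψ)
  | affine (α l : ℝ) (hα : α ≠ 0) : Microcosm ρ (affineMap α l hα)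
  | perm (τ : Equiv.Perm ℕ) (hτ : {n | τ n ≠ n}.Finite) : Microcosm ρ (permMap τ)
  | rho : Microcosm ρ (rhoMap ρ)
  | rho_symm : Microcosm ρ (rhoMap ρ).symm
  | exchange : Microcosm ρ xch

/-! ### Graphings -/

/-- A thick `Ω`-weighted graphing over `X` with dialect `[0,1]`. -/
structure Graphing (Ω : Type*) where
  support : Set Pt
  measurableSet_support : MeasurableSet support
  Edge : Type
  source : Edge → Set (Pt × I)
  measurableSet_source : ∀ e, MeasurableSet (source e)
  source_subset : ∀ e, source e ⊆ support ×ˢ univ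
  realiser : Edge → (Pt × I ≃ᵐ Pt × I)
  mapsTo : ∀ e, MapsTo (realiser e) (source e) (support ×ˢ univ)
  weight : Edge → Ω

/-- `(x, ρ(d, d')) ↦ ((x, d), d')`: a product dialect `[0,1] × [0,1]` is identified with `[0,1]`
through `ρ`. -/
def splitL (ρ : I × I ≃ᵐ I) : Pt × I ≃ᵐ (Pt × I) × I :=
  ((MeasurableEquiv.refl Pt).prodCongr ρ.symm).trans MeasurableEquiv.prodAssoc.symm

/-- `(x, ρ(d, d')) ↦ ((x, d'), d)`. -/
def splitR (ρ : I × I ≃ᵐ I) : Pt × I ≃ᵐ (Pt × I) × I :=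
  splitL (MeasurableEquiv.prodComm.trans ρ)

/-- `B : (a, s, d) ↦ (a, d • s)`. -/
def push : Pt × I ≃ᵐ Pt where
  toFun p := (p.1.1, consSeq p.2 p.1.2)
  invFun x := ((x.1, tailSeq x.2), x.2 0)
  left_inv _ := rfl
  right_inv x := Prod.ext rfl (consSeq_tailSeq x.2)
  measurable_toFun := (measurable_fst.comp measurable_fst).prodMk
    (measurable_consSeq.comp (measurable_snd.prodMk (measurable_snd.comp measurable_fst)))
  measurable_invFun := (measurable_fst.prodMk (measurable_tailSeq.comp measurable_snd)).prodMk
    ((measurable_pi_apply 0).comp measurable_snd)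

/-- `B² : (a, s, d, y) ↦ (a, (d, y) • s)`: the dialect goes to the first slot, the second slot is
fresh. -/
def push2 : (Pt × I) × I ≃ᵐ Pt where
  toFun p := push (push (p.1.1, p.2), p.1.2)
  invFun x := (((push.symm (push.symm x).1).1, (push.symm x).2), (push.symm (push.symm x).1).2)
  left_inv _ := by simp
  right_inv _ := by simp
  measurable_toFun := push.measurable.comp
    ((push.measurable.comp ((measurable_fst.comp measurable_fst).prodMk measurable_snd)).prodMk
      (measurable_snd.comp measurable_fst))
  measurable_invFun :=
    have h1 : Measurable push.symm := push.symm.measurable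
    have h2 : Measurable fun x => push.symm (push.symm x).1 := h1.comp (measurable_fst.comp h1)
    ((measurable_fst.comp h2).prodMk (measurable_snd.comp h1)).prodMk (measurable_snd.comp h2)

/-- The support of `!A` when `A` has support `S`: the points `(a, (d, y) • s)` with
`(a, s) ∈ S`. -/
def bangSupport (S : Set Pt) : Set Pt := push2.symm ⁻¹' ((S ×ˢ univ) ×ˢ univ)

lemma MeasurableSet.bangSupport {S : Set Pt} (hS : MeasurableSet S) :
    MeasurableSet (bangSupport S) :=
  push2.symm.measurable ((hS.prod MeasurableSet.univ).prod MeasurableSet.univ)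

lemma bangSupport_congr {S T : Set Pt} (h : S = T) : bangSupport S = bangSupport T := by rw [h]

/-- `raise : (a, (x, y) • s, e) ↦ (a, s, ρ(x, ρ(y, e)))`. -/
def raise (ρ : I × I ≃ᵐ I) : Pt × I ≃ᵐ Pt × I where
  toFun p := ((p.1.1, tailSeq (tailSeq p.1.2)), ρ (p.1.2 0, ρ (p.1.2 1, p.2)))
  invFun p := ((p.1.1, consSeq (ρ.symm p.2).1 (consSeq (ρ.symm (ρ.symm p.2).2).1 p.1.2)),
    (ρ.symm (ρ.symm p.2).2).2)
  left_inv p := by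
    refine Prod.ext (Prod.ext rfl ?_) ?_
    · funext n
      rcases n with _ | _ | n <;> simp [consSeq, tailSeq]
    · simp
  right_inv p := by
    refine Prod.ext (Prod.ext rfl ?_) ?_
    · funext n
      simp [consSeq, tailSeq]
    · simp [consSeq]
  measurable_toFun := by
    have ht : Measurable fun p : Pt × I => tailSeq (tailSeq p.1.2) :=
      measurable_tailSeq.comp (measurable_tailSeq.comp (by fun_prop))
    have h1 : Measurable fun p : Pt × I => ρ (p.1.2 1, p.2) := ρ.measurable.comp (by fun_prop)
    have h0 : Measurable fun p : Pt × I => p.1.2 0 := by fun_prop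
    exact ((measurable_fst.comp measurable_fst).prodMk ht).prodMk
      (ρ.measurable.comp (h0.prodMk h1))
  measurable_invFun := by
    have h : Measurable fun p : Pt × I => ρ.symm p.2 := ρ.symm.measurable.comp measurable_snd
    have h' : Measurable fun p : Pt × I => ρ.symm (ρ.symm p.2).2 :=
      ρ.symm.measurable.comp (measurable_snd.comp h)
    exact ((measurable_fst.comp measurable_fst).prodMk
      (measurable_consSeq.comp ((measurable_fst.comp h).prodMk
        (measurable_consSeq.comp ((measurable_fst.comp h').prodMk (by fun_prop)))))).prodMk
      (measurable_snd.comp h')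

/-- `θ × Id` on `X × [0,1]`. -/
def timesIdMap (θ : Pt ≃ᵐ Pt) : Pt × I ≃ᵐ Pt × I := θ.prodCongr (MeasurableEquiv.refl I)

namespace Graphing

variable {Ω : Type*}

/-- The image `B(G)` of a graphing under a Borel automorphism of `X × [0,1]` carrying
`support × [0,1]` onto `W × [0,1]`: edges are transported to `B ∘ φ ∘ B⁻¹`. -/
def map (G : Graphing Ω) (B : Pt × I ≃ᵐ Pt × I) (W : Set Pt) (hW : MeasurableSet W)
    (h : ∀ p, p.1 ∈ G.support ↔ (B p).1 ∈ W) : Graphing Ω where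
  support := W
  measurableSet_support := hW
  Edge := G.Edge
  source e := B.symm ⁻¹' G.source e
  measurableSet_source e := B.symm.measurable (G.measurableSet_source e)
  source_subset e p hp := by
    have h1 := (h _).1 (G.source_subset e hp).1
    rw [B.apply_symm_apply] at h1
    exact ⟨h1, mem_univ _⟩
  realiser e := B.symm.trans ((G.realiser e).trans B)
  mapsTo e _ hp := ⟨(h _).1 (G.mapsTo e hp).1, mem_univ _⟩
  weight := G.weight

/-- The graphing acting as `G` through an identification `c` of its dialect with the last factor
of `(X × [0,1]) × [0,1]`, and as the identity on that factor. -/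
def lift (G : Graphing Ω) (c : Pt × I ≃ᵐ (Pt × I) × I) (hc : ∀ p, (c p).1.1 = p.1) :
    Graphing Ω where
  support := G.support
  measurableSet_support := G.measurableSet_support
  Edge := G.Edge
  source e := {p | (c p).1 ∈ G.source e}
  measurableSet_source e := (measurable_fst.comp c.measurable) (G.measurableSet_source e)
  source_subset e p hp := by
    have h1 := (G.source_subset e hp).1
    rw [hc] at h1
    exact ⟨h1, mem_univ _⟩
  realiser e := c.trans (((G.realiser e).prodCongr (MeasurableEquiv.refl I)).trans c.symm)
  mapsTo e p hp := by
    have h1 := (G.mapsTo e hp).1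
    refine ⟨?_, mem_univ _⟩
    have h2 := hc (c.symm ((G.realiser e) (c p).1, (c p).2))
    rw [c.apply_symm_apply] at h2
    change (c.symm ((G.realiser e) (c p).1, (c p).2)).1 ∈ G.support
    rw [← h2]
    exact h1
  weight := G.weight

/-- `G × Id_[0,1]`, of dialect `[0,1] × [0,1]`: edges `(x, ρ(d, d')) ↦ (x', ρ(d₁, d'))` where
`φ (x, d) = (x', d₁)`. -/
def timesId (ρ : I × I ≃ᵐ I) (G : Graphing Ω) : Graphing Ω := G.lift (splitL ρ) fun _ => rfl

/-- `Id_[0,1] × G`: the same with the two dialects in the other order. -/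
def idTimes (ρ : I × I ≃ᵐ I) (G : Graphing Ω) : Graphing Ω := G.lift (splitR ρ) fun _ => rfl

/-- Perennisation `!G = B²(G × Id)`: the dialect-free graphing with edges
`(B²(p, y), e) ↦ (B²(φ p, y), e)`. -/
def bang (G : Graphing Ω) : Graphing Ω where
  support := bangSupport G.support
  measurableSet_support := MeasurableSet.bangSupport G.measurableSet_support
  Edge := G.Edge
  source e := {p | (push2.symm p.1).1 ∈ G.source e}
  measurableSet_source e :=
    (measurable_fst.comp (push2.symm.measurable.comp measurable_fst)) (G.measurableSet_source e)
  source_subset e _ hp := ⟨⟨G.source_subset e hp, mem_univ _⟩, mem_univ _⟩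
  realiser e := timesIdMap
    (push2.symm.trans (((G.realiser e).prodCongr (MeasurableEquiv.refl I)).trans push2))
  mapsTo e p hp := by
    refine ⟨?_, mem_univ _⟩
    change (push2.symm (push2 ((G.realiser e) (push2.symm p.1).1, (push2.symm p.1).2))) ∈
      (G.support ×ˢ univ) ×ˢ univ
    rw [push2.symm_apply_apply]
    exact ⟨G.mapsTo e hp, mem_univ _⟩
  weight := G.weight

/-- `raise(!G)`. -/
def raiseBang (ρ : I × I ≃ᵐ I) (G : Graphing Ω) : Graphing Ω :=
  G.bang.map (raise ρ) G.support G.measurableSet_support fun _ =>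
    ⟨fun h => h.1.1, fun h => ⟨⟨h, mem_univ _⟩, mem_univ _⟩⟩

/-- The delocation `θ(G)` along a Borel automorphism `θ` of `X`. -/
def deloc (θ : Pt ≃ᵐ Pt) (G : Graphing Ω) : Graphing Ω :=
  G.map (timesIdMap θ) (θ '' G.support) (θ.measurableSet_image.2 G.measurableSet_support)
    fun p => by
      change p.1 ∈ G.support ↔ θ p.1 ∈ θ '' G.support
      rw [θ.injective.mem_set_image]

/-- All realisers belong to the microcosm. -/
def InMicrocosm (ρ : I × I ≃ᵐ I) (G : Graphing Ω) : Prop := ∀ e, Microcosm ρ (G.realiser e)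

/-- Equality of graphings: same support and, edges of negligible source being discarded, a
weight-preserving bijection between the edges such that corresponding sources are equal and
corresponding realisers agree on them, up to negligible sets. -/
def AEEq (F G : Graphing Ω) : Prop :=
  F.support = G.support ∧
  ∃ e : {f : F.Edge // muXI (F.source f) ≠ 0} ≃ {g : G.Edge // muXI (G.source g) ≠ 0},
    ∀ f, F.weight f.1 = G.weight (e f).1 ∧
      F.source f.1 =ᵐ[muXI] G.source (e f).1 ∧
      ∀ᵐ p ∂muXI, p ∈ F.source f.1 → F.realiser f.1 p = G.realiser (e f).1 p

/-! ### Paths, execution and measurement -/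

section Paths

variable {E : Type} (src : E → Set (Pt × I)) (rel : E → (Pt × I ≃ᵐ Pt × I)) (wt : E → Ω)

/-- The realiser `φ_{e_k} ∘ ⋯ ∘ φ_{e_1}` of the path `e_1, …, e_k`. -/
def pathRealiser : List E → (Pt × I ≃ᵐ Pt × I)
  | [] => MeasurableEquiv.refl _
  | e :: π => (rel e).trans (pathRealiser π)

/-- The maximal domain of a path. -/
def pathSource : List E → Set (Pt × I)
  | [] => univ
  | e :: π => src e ∩ rel e ⁻¹' pathSource π

/-- The weight `ω(e_k) ⋯ ω(e_1)` of the path `e_1, …, e_k`. -/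
def pathWeight [Monoid Ω] : List E → Ω
  | [] => 1
  | e :: π => pathWeight π * wt e

variable {src rel}

lemma measurableSet_pathSource (h : ∀ e, MeasurableSet (src e)) :
    ∀ π, MeasurableSet (pathSource src rel π)
  | [] => MeasurableSet.univ
  | e :: π => (h e).inter ((rel e).measurable (measurableSet_pathSource h π))

lemma pathSource_subset {U : Set (Pt × I)} (h : ∀ e, src e ⊆ U) :
    ∀ π, π ≠ [] → pathSource src rel π ⊆ U
  | [], h0 => absurd rfl h0
  | e :: _, _ => fun _ hp => h e hp.1

lemma mapsTo_pathRealiser {U : Set (Pt × I)} (h : ∀ e, MapsTo (rel e) (src e) U) :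
    ∀ π, π ≠ [] → MapsTo (pathRealiser rel π) (pathSource src rel π) U
  | [], h0 => absurd rfl h0
  | [e], _ => fun _ hp => h e hp.1
  | _ :: e' :: π, _ => fun _ hp =>
      mapsTo_pathRealiser h (e' :: π) (List.cons_ne_nil _ _) hp.2

end Paths

/-- The sources, in `X × [0,1]`, of the edges of `F` and `G`: the dialect is the product of the
dialect of `F` and the dialect of `G` (identified with `[0,1]` through `ρ`), and an edge of one
graphing does not change the dialect of the other. -/
def pairSource (ρ : I × I ≃ᵐ I) (F G : Graphing Ω) : F.Edge ⊕ G.Edge → Set (Pt × I) :=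
  Sum.elim (F.timesId ρ).source (G.idTimes ρ).source

/-- The realisers of the edges of `F` and `G` on the product dialect. -/
def pairRealiser (ρ : I × I ≃ᵐ I) (F G : Graphing Ω) : F.Edge ⊕ G.Edge → (Pt × I ≃ᵐ Pt × I) :=
  Sum.elim (F.timesId ρ).realiser (G.idTimes ρ).realiser

/-- The weights of the edges of `F` and `G`. -/
def pairWeight (F G : Graphing Ω) : F.Edge ⊕ G.Edge → Ω := Sum.elim F.weight G.weight

/-- Two consecutive edges of an alternating path belong to different graphings. -/
def Alternate {E E' : Type} (a b : E ⊕ E') : Prop := a.isLeft ≠ b.isLeft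

/-- The source of the restriction of the alternating path `π` to the complement of the cut: both
end points lie outside the intersection of the supports. -/
def hiddenSource (ρ : I × I ≃ᵐ I) (F G : Graphing Ω) (π : List (F.Edge ⊕ G.Edge)) :
    Set (Pt × I) :=
  {p | p ∈ pathSource (pairSource ρ F G) (pairRealiser ρ F G) π ∧
    p.1 ∉ F.support ∩ G.support ∧
    (pathRealiser (pairRealiser ρ F G) π p).1 ∉ F.support ∩ G.support}

lemma pairSource_subset (ρ : I × I ≃ᵐ I) (F G : Graphing Ω) (e : F.Edge ⊕ G.Edge) :
    pairSource ρ F G e ⊆ (F.support ∪ G.support) ×ˢ univ := by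
  rcases e with e | e
  · exact fun p hp => ⟨Or.inl ((F.timesId ρ).source_subset e hp).1, mem_univ _⟩
  · exact fun p hp => ⟨Or.inr ((G.idTimes ρ).source_subset e hp).1, mem_univ _⟩

lemma pair_mapsTo (ρ : I × I ≃ᵐ I) (F G : Graphing Ω) (e : F.Edge ⊕ G.Edge) :
    MapsTo (pairRealiser ρ F G e) (pairSource ρ F G e) ((F.support ∪ G.support) ×ˢ univ) := by
  rcases e with e | e
  · exact fun p hp => ⟨Or.inl ((F.timesId ρ).mapsTo e hp).1, mem_univ _⟩
  · exact fun p hp => ⟨Or.inr ((G.idTimes ρ).mapsTo e hp).1, mem_univ _⟩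

lemma measurableSet_pairSource (ρ : I × I ≃ᵐ I) (F G : Graphing Ω) (e : F.Edge ⊕ G.Edge) :
    MeasurableSet (pairSource ρ F G e) := by
  rcases e with e | e
  · exact (F.timesId ρ).measurableSet_source e
  · exact (G.idTimes ρ).measurableSet_source e

lemma mem_symmDiff_of {U V : Set Pt} {x : Pt} (h : x ∈ U ∪ V) (h' : x ∉ U ∩ V) :
    x ∈ symmDiff U V := by
  by_cases hU : x ∈ U
  · exact Or.inl ⟨hU, fun hV => h' ⟨hU, hV⟩⟩
  · exact Or.inr ⟨h.resolve_left hU, hU⟩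

/-- The execution `F :: G`, of support the symmetric difference of the supports and of dialect the
product of the dialects: its edges are the (non-negligible) restrictions to the complement of the
cut of the alternating paths between `F` and `G`. -/
def exec [Monoid Ω] (ρ : I × I ≃ᵐ I) (F G : Graphing Ω) : Graphing Ω where
  support := symmDiff F.support G.support
  measurableSet_support := F.measurableSet_support.symmDiff G.measurableSet_support
  Edge := {π : List (F.Edge ⊕ G.Edge) //
    π ≠ [] ∧ π.IsChain Alternate ∧ muXI (hiddenSource ρ F G π) ≠ 0}
  source π := hiddenSource ρ F G π.1
  measurableSet_source π := by
    have hC : MeasurableSet (F.support ∩ G.support) :=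
      F.measurableSet_support.inter G.measurableSet_support
    exact (measurableSet_pathSource (measurableSet_pairSource ρ F G) π.1).inter
      ((measurable_fst hC.compl).inter
        ((measurable_fst.comp (pathRealiser (pairRealiser ρ F G) π.1).measurable) hC.compl))
  source_subset π _ hp := ⟨mem_symmDiff_of
    (pathSource_subset (pairSource_subset ρ F G) π.1 π.2.1 hp.1).1 hp.2.1, mem_univ _⟩
  realiser π := pathRealiser (pairRealiser ρ F G) π.1
  mapsTo π _ hp := ⟨mem_symmDiff_of
    (mapsTo_pathRealiser (pair_mapsTo ρ F G) π.1 π.2.1 hp.1).1 hp.2.2, mem_univ _⟩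
  weight π := pathWeight (pairWeight F G) π.1

/-- Rooted alternating circuits between `F` and `G`: non-empty sequences of edges that alternate
cyclically and are not proper powers of a shorter sequence. -/
def IsCircuit {E E' : Type} (π : List (E ⊕ E')) : Prop :=
  π ≠ [] ∧ Cycle.Chain Alternate (π : Cycle (E ⊕ E')) ∧
    ∀ (l : List (E ⊕ E')) (k : ℕ), π = (List.replicate k l).flatten → k = 1

/-- The support of a circuit `π`: the points of finite orbit under the partial map `φ_π`. -/
def circuitSupport (ρ : I × I ≃ᵐ I) (F G : Graphing Ω) (π : List (F.Edge ⊕ G.Edge)) :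
    Set (Pt × I) :=
  {p | p ∈ Function.periodicPts (pathRealiser (pairRealiser ρ F G) π) ∧
    ∀ n : ℕ, (pathRealiser (pairRealiser ρ F G) π)^[n] p ∈
      pathSource (pairSource ρ F G) (pairRealiser ρ F G) π}

/-- The measure `∫_{supp π} m(ω(π)^{r(x)}) / r(x)` of a circuit, where `r(x)` is the length of the
orbit of `x` under `φ_π`. -/
def circuitMeas [Monoid Ω] (ρ : I × I ≃ᵐ I) (m : Ω → ℝ≥0∞) (F G : Graphing Ω)
    (π : List (F.Edge ⊕ G.Edge)) : ℝ≥0∞ :=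
  ∫⁻ p in circuitSupport ρ F G π,
    m (pathWeight (pairWeight F G) π ^
        Function.minimalPeriod (pathRealiser (pairRealiser ρ F G) π) p) /
      (Function.minimalPeriod (pathRealiser (pairRealiser ρ F G) π) p : ℝ≥0∞) ∂muXI

/-- The measurement `⟦F, G⟧`: the sum of the measures of the alternating circuits taken up to
cyclic permutation. A circuit of length `n` has `n` rooted representatives, which all have the
same measure when the realisers preserve the measure; the mean over the representatives makes the
value independent of a choice of representatives in general. -/
def meas [Monoid Ω] (ρ : I × I ≃ᵐ I) (m : Ω → ℝ≥0∞) (F G : Graphing Ω) : ℝ≥0∞ :=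
  ∑' π : {π : List (F.Edge ⊕ G.Edge) // IsCircuit π},
    circuitMeas ρ m F G π.1 / (π.1.length : ℝ≥0∞)

end Graphing

/-! ### Projects -/

/-- A project: a wager in `[0,∞]` and a finite formal weighted sum of graphings of the same
support. -/
structure Project (Ω : Type*) where
  wager : ℝ≥0∞
  support : Set Pt
  Index : Type
  [fintype : Fintype Index]
  coeff : Index → ℝ
  slice : Index → Graphing Ω
  slice_support : ∀ i, (slice i).support = support

attribute [instance] Project.fintype

namespace Project

variable {Ω : Type*}

/-- Apply an operation to all slices of a project. -/
def mapSlices (a : Project Ω) (f : Graphing Ω → Graphing Ω) (S : Set Pt)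
    (h : ∀ G : Graphing Ω, G.support = a.support → (f G).support = S) : Project Ω where
  wager := a.wager
  support := S
  Index := a.Index
  coeff := a.coeff
  slice i := f (a.slice i)
  slice_support i := h _ (a.slice_support i)

/-- The perennisation `!a`. -/
def bang (a : Project Ω) : Project Ω :=
  a.mapSlices Graphing.bang (bangSupport a.support) fun _ h => bangSupport_congr h

/-- `raise(!a)`. -/
def raiseBang (ρ : I × I ≃ᵐ I) (a : Project Ω) : Project Ω :=
  a.mapSlices (Graphing.raiseBang ρ) a.support fun _ h => h

/-- `a × Id_[0,1]`: the project `a` with an additional, unused, dialect component. -/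
def timesId (ρ : I × I ≃ᵐ I) (a : Project Ω) : Project Ω :=
  a.mapSlices (Graphing.timesId ρ) a.support fun _ h => h

/-- The delocation `θ(a)`. -/
def deloc (θ : Pt ≃ᵐ Pt) (a : Project Ω) : Project Ω :=
  a.mapSlices (Graphing.deloc θ) (θ '' a.support) fun _ h => congrArg (fun S => θ '' S) h

/-- A project is balanced if its wager is `0` and its sliced graphing is a single graphing (of
dialect `[0,1]`). -/
def IsBalanced (a : Project Ω) : Prop :=
  a.wager = 0 ∧ Nonempty (Unique a.Index) ∧ ∀ i, a.coeff i = 1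

/-- A project is winning if it is balanced and its graphing is a disjoint union of
transpositions. -/
def IsWinning (a : Project Ω) : Prop :=
  a.IsBalanced ∧ ∀ i,
    (∀ e, ∃ e', (a.slice i).source e' = (a.slice i).realiser e '' (a.slice i).source e ∧
      (a.slice i).realiser e' = ((a.slice i).realiser e).symm) ∧
    Pairwise fun e e' => Disjoint ((a.slice i).source e) ((a.slice i).source e')

/-- All realisers belong to the microcosm. -/
def InMicrocosm (ρ : I × I ≃ᵐ I) (a : Project Ω) : Prop := ∀ i, (a.slice i).InMicrocosm ρ

/-- Equality of projects: equal wagers and, up to re-indexing, equal coefficients and slices. -/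
def AEEq (a b : Project Ω) : Prop :=
  a.wager = b.wager ∧ a.support = b.support ∧
    ∃ e : a.Index ≃ b.Index, ∀ i,
      a.coeff i = b.coeff (e i) ∧ (a.slice i).AEEq (b.slice (e i))

/-- The sum of the coefficients. -/
def total (a : Project Ω) : ℝ := ∑ i, a.coeff i

variable [Monoid Ω] (ρ : I × I ≃ᵐ I) (m : Ω → ℝ≥0∞)

/-- The measurement of two projects: `a 1_B + b 1_A + ⟦A, B⟧`. -/
def pairing (a b : Project Ω) : EReal :=
  (a.wager : EReal) * (b.total : EReal) + (b.wager : EReal) * (a.total : EReal) +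
    ∑ i, ∑ j, ((a.coeff i * b.coeff j : ℝ) : EReal) *
      ((Graphing.meas ρ m (a.slice i) (b.slice j) : ℝ≥0∞) : EReal)

/-- Orthogonality: equal supports, and a finite non-zero measurement. -/
def Orthogonal (a b : Project Ω) : Prop :=
  a.support = b.support ∧ pairing ρ m a b ≠ 0 ∧ pairing ρ m a b ≠ ⊤ ∧ pairing ρ m a b ≠ ⊥

/-- The execution `a :: b = (a 1_B + b 1_A + ⟦A, B⟧, A :: B)`, meaningful when the measurement is
non-negative. -/
def exec (a b : Project Ω) : Project Ω where
  wager := (pairing ρ m a b).toENNReal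
  support := symmDiff a.support b.support
  Index := a.Index × b.Index
  coeff i := a.coeff i.1 * b.coeff i.2
  slice i := (a.slice i.1).exec ρ (b.slice i.2)
  slice_support i := by
    change symmDiff (a.slice i.1).support (b.slice i.2).support = _
    rw [a.slice_support, b.slice_support]

end Project

/-! ### Conducts -/

variable {Ω : Type*} [Monoid Ω] (ρ : I × I ≃ᵐ I) (m : Ω → ℝ≥0∞)

/-- The orthogonal of a set of projects of support `V`, among the projects of support `V` all of
whose realisers are in the microcosm. -/
def polar (V : Set Pt) (T : Set (Project Ω)) : Set (Project Ω) :=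
  {a | a.InMicrocosm ρ ∧ a.support = V ∧ ∀ b ∈ T, Project.Orthogonal ρ m a b}

/-- Conducts of support `V`. -/
def IsConduct (V : Set Pt) (A : Set (Project Ω)) : Prop :=
  MeasurableSet V ∧ A = polar ρ m V (polar ρ m V A)

/-- The perennial conduct `!A`: the bi-orthogonal of `{!a | a ∈ A balanced}`. -/
def bangConduct (V : Set Pt) (A : Set (Project Ω)) : Set (Project Ω) :=
  polar ρ m (bangSupport V) (polar ρ m (bangSupport V)
    {p | ∃ a ∈ A, a.IsBalanced ∧ p = a.bang})

/-- The conduct `θ(A)`, copy of `A` on the support `θ(V)`: the bi-orthogonal of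
`{θ(a) | a ∈ A}`. -/
def delocConduct (θ : Pt ≃ᵐ Pt) (V : Set Pt) (A : Set (Project Ω)) : Set (Project Ω) :=
  polar ρ m (θ '' V) (polar ρ m (θ '' V) (Project.deloc θ '' A))

/-- The conduct `A ⊸ B`, for conducts of disjoint supports `V` and `W`: the projects `f` of support
`V ∪ W` such that, for all `a ∈ A`, the execution `f :: a` is defined (its wager is in `[0,∞]`) and
belongs to `B`. -/
def linImp (V W : Set Pt) (A B : Set (Project Ω)) : Set (Project Ω) :=
  {f | f.InMicrocosm ρ ∧ f.support = V ∪ W ∧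
    ∀ a ∈ A, 0 ≤ Project.pairing ρ m f a ∧ Project.exec ρ m f a ∈ B}

end

end InteractionGraphs

open InteractionGraphs

namespace InteractionGraphs

/-! ### Measure-preserving rearrangements -/

/-! Dereliction is a fax. Put `U = !V`, `W = θ(V)` and `B = θ ∘ raise`. The graphing has two edges,
`B` from `U × [0,1]` to `W × [0,1]` and its inverse, so it is winning and lies in the microcosm as
soon as `raise` does.

Let `G` have support `U`. Since `U` and `W` are disjoint, an edge of `G` can neither follow the edge
into `W` nor precede the edge out of `W`. Hence there are no circuits of positive measure, and the
only paths that avoid the cut `U` at both ends go from `W` to `U` by `B⁻¹`, take one edge of `G`,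
and return by `B` (`exists_eq_of_hiddenSource`). Thus executing the fax against `G` transports `G`
along `B` and keeps wagers. For `G = !A`, `raise` takes the two slots pushed into the sequence back
into the dialect: the one that stores the dialect of `A` comes first, everything else is idle, and
the result is `A × Id`, moved by `θ`.

The substantial point is that the fax sends the whole bi-orthogonal `!A` into the bi-orthogonal
`θ(A)`. Let `b` be in `!A` and let `c` be orthogonal to all `θ(a)`. Two identities suffice: `⟨fax ::
b, c⟩ = ⟨b, B⁻¹(c)⟩` (`meas_exec_fax`) and `⟨B⁻¹(c), !a⟩ = ⟨c, θ(a)⟩` (`meas_relocate_bang`). By the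
second, `B⁻¹(c)` is orthogonal to every generator `!a`, hence to `b`; by the first, `fax :: b` is
orthogonal to `c`.

Both identities are instances of `Factors.meas`: if a measure-preserving `T` carries the edges of
one pair of graphings to those of another, up to an idle component, then circuits, supports, periods
and weights correspond. Closure of the microcosm under the action on one factor of a product dialect
(`liftMap_splitL`, `liftMap_splitR`) keeps all graphings involved in the microcosm. -/

instance : SFinite muX := by unfold muX; infer_instance

instance : SFinite muXI := by unfold muXI; infer_instance

lemma measurePreserving_prodMap {α β γ δ : Type*} [MeasurableSpace α] [MeasurableSpace β]
    [MeasurableSpace γ] [MeasurableSpace δ] {μ : Measure α} {ν : Measure β} {μ' : Measure γ}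
    {ν' : Measure δ} [SFinite μ] [SFinite ν] [SFinite μ'] [SFinite ν'] {f : α → β} {g : γ → δ}
    (hf : MeasurePreserving f μ ν) (hg : MeasurePreserving g μ' ν') :
    MeasurePreserving (Prod.map f g) (μ.prod μ') (ν.prod ν') :=
  ⟨hf.measurable.prodMap hg.measurable, by
    rw [← Measure.map_prod_map _ _ hf.measurable hg.measurable, hf.map_eq, hg.map_eq]⟩

/-- `((a, b), c) ↦ ((a, c), b)` preserves the product measure. -/
lemma measurePreserving_prod_right_comm {α β γ : Type*} [MeasurableSpace α] [MeasurableSpace β]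
    [MeasurableSpace γ] (μ : Measure α) (ν : Measure β) (τ : Measure γ)
    [SFinite μ] [SFinite ν] [SFinite τ] :
    MeasurePreserving (fun p : (α × β) × γ => ((p.1.1, p.2), p.1.2))
      ((μ.prod ν).prod τ) ((μ.prod τ).prod ν) :=
  ((measurePreserving_prodAssoc μ τ ν).symm.comp
    (measurePreserving_prodMap (MeasurePreserving.id μ) Measure.measurePreserving_swap)).comp
    (measurePreserving_prodAssoc μ ν τ)

lemma measurePreserving_consSeq :
    MeasurePreserving (fun p : I × Cube => consSeq p.1 p.2)
      ((volume : Measure I).prod (Measure.infinitePi fun _ : ℕ => (volume : Measure I)))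
      (Measure.infinitePi fun _ : ℕ => (volume : Measure I)) := by
  refine ⟨measurable_consSeq, Measure.eq_infinitePi _ fun s t ht => ?_⟩
  rw [Measure.map_apply measurable_consSeq (.pi s.countable_toSet fun i _ => ht i)]
  set t' : ℕ → Set I := fun n => if n ∈ s then t n else univ with ht'
  have hmt' : ∀ n, MeasurableSet (t' n) := fun n => by
    by_cases h : n ∈ s <;> simp [ht', h, ht]
  -- Enlarging `s` to an initial segment lets the preimage split into the coordinate `0` and a
  -- shifted box; the added factors are `univ`, of measure one.
  obtain ⟨N, hN⟩ : ∃ N, s ⊆ Finset.range (N + 1) :=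
    ⟨s.sup id, fun n hn => Finset.mem_range.2 (Nat.lt_succ_of_le (Finset.le_sup (f := id) hn))⟩
  have hpre : (fun p : I × Cube => consSeq p.1 p.2) ⁻¹' Set.pi s t =
      t' 0 ×ˢ Set.pi (Finset.range N) fun n => t' (n + 1) := by
    ext ⟨x, y⟩
    simp only [mem_preimage, Set.mem_pi, Finset.mem_coe, mem_prod, Finset.mem_range]
    constructor
    · intro h
      refine ⟨?_, fun n _ => ?_⟩
      · by_cases h0 : 0 ∈ s
        · simpa [consSeq, ht', h0] using h 0 h0
        · simp [ht', h0]
      · by_cases h0 : n + 1 ∈ s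
        · simpa [consSeq, ht', h0] using h (n + 1) h0
        · simp [ht', h0]
    · rintro ⟨h0, h1⟩ n hn
      rcases n with _ | n
      · simpa [consSeq, ht', hn] using h0
      · have := h1 n (Nat.lt_of_succ_lt_succ (Finset.mem_range.1 (hN hn)))
        simpa [consSeq, ht', hn] using this
  rw [hpre, Measure.prod_prod, Measure.infinitePi_pi _ fun i _ => hmt' _, mul_comm,
    ← Finset.prod_range_succ' (fun n => volume (t' n)), ← Finset.prod_subset hN]
  · exact Finset.prod_congr rfl fun n hn => by simp [ht', hn]
  · intro n _ hn
    simp [ht', hn]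

lemma measurePreserving_push : MeasurePreserving push muXI muX :=
  (measurePreserving_prodMap (MeasurePreserving.id volume)
    (measurePreserving_consSeq.comp Measure.measurePreserving_swap)).comp
    (measurePreserving_prodAssoc _ _ _)

lemma measurePreserving_xch : MeasurePreserving xch muXI muXI :=
  (measurePreserving_prodMap measurePreserving_push (MeasurePreserving.id volume)).comp
    ((measurePreserving_prod_right_comm muX volume volume).comp
      (measurePreserving_prodMap measurePreserving_push.symm (MeasurePreserving.id volume)))

lemma measurePreserving_permMap (τ : Equiv.Perm ℕ) : MeasurePreserving (permMap τ) muXI muXI := by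
  have h : MeasurePreserving (fun (s : Cube) n => s (τ n))
      (Measure.infinitePi fun _ : ℕ => (volume : Measure I))
      (Measure.infinitePi fun _ : ℕ => (volume : Measure I)) :=
    ⟨by fun_prop, Measure.map_infinitePi_infinitePi_of_inj τ.injective⟩
  exact measurePreserving_prodMap (measurePreserving_prodMap (MeasurePreserving.id volume) h)
    (MeasurePreserving.id volume)

lemma measurePreserving_timesIdMap {θ : Pt ≃ᵐ Pt} (hθ : MeasurePreserving θ muX muX) :
    MeasurePreserving (timesIdMap θ) muXI muXI :=
  measurePreserving_prodMap hθ (MeasurePreserving.id volume)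

/-! ### Invariance of the measure and of null sets -/

section

variable {ρ : I × I ≃ᵐ I}

lemma measurePreserving_rhoMap (hρ : MeasurePreserving ρ volume volume) :
    MeasurePreserving (rhoMap ρ) muXI muXI := by
  have h : MeasurePreserving (fun p : (Pt × I) × I => (p.1.1, ρ (p.2, p.1.2)))
      (muXI.prod volume) muXI :=
    (measurePreserving_prodMap (MeasurePreserving.id muX)
      (hρ.comp Measure.measurePreserving_swap)).comp (measurePreserving_prodAssoc _ _ _)
  exact measurePreserving_prodMap (measurePreserving_push.comp (h.comp
    ((measurePreserving_prodMap measurePreserving_push.symm (MeasurePreserving.id volume)).comp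
      measurePreserving_push.symm))) (MeasurePreserving.id volume)

lemma measurePreserving_splitL (hρ : MeasurePreserving ρ volume volume) :
    MeasurePreserving (splitL ρ) muXI (muXI.prod volume) :=
  (measurePreserving_prodAssoc _ _ _).symm.comp
    (measurePreserving_prodMap (MeasurePreserving.id muX) hρ.symm)

lemma measurePreserving_raise (hρ : MeasurePreserving ρ volume volume) :
    MeasurePreserving (raise ρ) muXI muXI := by
  -- Coordinates taken off by `push.symm` arrive as `(y, x)`, which explains the reversed indices.
  have h : MeasurePreserving (fun p : (I × I) × I => ρ (p.1.2, ρ (p.1.1, p.2)))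
      ((volume.prod volume).prod volume) volume :=
    hρ.comp ((measurePreserving_prodMap (MeasurePreserving.id volume) hρ).comp
      ((measurePreserving_prodAssoc volume volume volume).comp
        (measurePreserving_prodMap Measure.measurePreserving_swap (MeasurePreserving.id volume))))
  have h' : MeasurePreserving (fun p : Pt => ((push.symm (push.symm p).1).1,
      ((push.symm (push.symm p).1).2, (push.symm p).2))) muX (muX.prod (volume.prod volume)) :=
    (measurePreserving_prodAssoc _ _ _).comp ((measurePreserving_prodMap
      measurePreserving_push.symm (MeasurePreserving.id volume)).comp measurePreserving_push.symm)
  exact (measurePreserving_prodMap (MeasurePreserving.id muX) h).comp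
    ((measurePreserving_prodAssoc _ _ _).comp
      (measurePreserving_prodMap h' (MeasurePreserving.id volume)))

lemma quasiMeasurePreserving_affineMap (α l : ℝ) (hα : α ≠ 0) :
    Measure.QuasiMeasurePreserving (affineMap α l hα) muXI muXI := by
  have h1 : Measure.QuasiMeasurePreserving (fun x : ℝ => α * x) volume volume :=
    ⟨by fun_prop, by
      rw [Real.map_volume_mul_left hα]
      exact Measure.smul_absolutelyContinuous⟩
  have h2 : Measure.QuasiMeasurePreserving (fun x : ℝ => α * x + l) volume volume :=
    (measurePreserving_add_right volume l).quasiMeasurePreserving.comp h1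
  exact QuasiMeasurePreserving.prodMap (QuasiMeasurePreserving.prodMap h2 (.id _)) (.id _)

/-- Affine maps rescale the measure, so only null sets are controlled. This is enough to discard
paths through edges of negligible source. -/
lemma Microcosm.quasiMeasurePreserving (hρ : MeasurePreserving ρ volume volume)
    {φ : Pt × I ≃ᵐ Pt × I} (h : Microcosm ρ φ) :
    Measure.QuasiMeasurePreserving φ muXI muXI := by
  induction h with
  | one => exact .id _
  | comp _ _ h1 h2 => exact h2.comp h1
  | affine α l hα => exact quasiMeasurePreserving_affineMap α l hα
  | perm τ _ => exact (measurePreserving_permMap τ).quasiMeasurePreserving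
  | rho => exact (measurePreserving_rhoMap hρ).quasiMeasurePreserving
  | rho_symm => exact (measurePreserving_rhoMap hρ).symm.quasiMeasurePreserving
  | exchange => exact measurePreserving_xch.quasiMeasurePreserving

end

/-! ### The microcosm -/

/-- The action of `φ` through an identification of the dialect with the last factor of
`(X × [0,1]) × [0,1]`. -/
def liftMap (c : Pt × I ≃ᵐ (Pt × I) × I) (φ : Pt × I ≃ᵐ Pt × I) : Pt × I ≃ᵐ Pt × I :=
  c.trans ((φ.prodCongr (MeasurableEquiv.refl I)).trans c.symm)

lemma liftMap_refl (c : Pt × I ≃ᵐ (Pt × I) × I) :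
    liftMap c (MeasurableEquiv.refl _) = MeasurableEquiv.refl _ := by
  refine MeasurableEquiv.ext (funext fun p => ?_)
  exact c.symm_apply_apply p

lemma liftMap_trans (c : Pt × I ≃ᵐ (Pt × I) × I) (φ ψ : Pt × I ≃ᵐ Pt × I) :
    liftMap c (φ.trans ψ) = (liftMap c φ).trans (liftMap c ψ) := by
  refine MeasurableEquiv.ext (funext fun p => ?_)
  change c.symm (ψ (φ (c p).1), (c p).2) =
    c.symm (ψ (c (c.symm (φ (c p).1, (c p).2))).1, (c (c.symm (φ (c p).1, (c p).2))).2)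
  rw [c.apply_symm_apply]

namespace Microcosm

variable {ρ : I × I ≃ᵐ I}

lemma symm {φ : Pt × I ≃ᵐ Pt × I} (h : Microcosm ρ φ) : Microcosm ρ φ.symm := by
  induction h with
  | one => exact one
  | comp _ _ h1 h2 => exact comp h2 h1
  | affine α l hα =>
    have h : (affineMap α l hα).symm = affineMap α⁻¹ (-(α⁻¹ * l)) (inv_ne_zero hα) := by
      refine MeasurableEquiv.ext (funext fun p => ?_)
      refine Prod.ext (Prod.ext ?_ rfl) rfl
      change α⁻¹ * (p.1.1 - l) = α⁻¹ * p.1.1 + -(α⁻¹ * l)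
      ring
    rw [h]
    exact affine _ _ _
  | perm τ hτ =>
    refine perm τ.symm (hτ.subset fun n hn h => hn ?_)
    exact (τ.symm_apply_eq.2 h.symm)
  | rho => exact rho_symm
  | rho_symm => exact rho
  | exchange => exact exchange

/-- The transposition of the first two coordinates of the Hilbert cube. -/
lemma perm_swap : Microcosm ρ (permMap (Equiv.swap 0 1)) :=
  perm _ ((Set.toFinite {0, 1}).subset fun n hn => by
    by_contra h
    simp only [mem_insert_iff, mem_singleton_iff, not_or] at h
    exact hn (Equiv.swap_apply_of_ne_of_ne h.1 h.2))

end Microcosm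

@[simp] lemma consSeq_zero (x : I) (s : Cube) : consSeq x s 0 = x := rfl

@[simp] lemma consSeq_one (x : I) (s : Cube) : consSeq x s 1 = s 0 := rfl

@[simp] lemma tailSeq_consSeq (x : I) (s : Cube) : tailSeq (consSeq x s) = s := rfl

lemma permMap_swap_apply (p : Pt × I) :
    permMap (Equiv.swap 0 1) p =
      ((p.1.1, consSeq (p.1.2 1) (consSeq (p.1.2 0) (tailSeq (tailSeq p.1.2)))), p.2) := by
  refine Prod.ext (Prod.ext rfl ?_) rfl
  funext n
  rcases n with _ | _ | n
  · simp [permMap, consSeq]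
  · simp [permMap, consSeq]
  · have : (Equiv.swap 0 1 : Equiv.Perm ℕ) (n + 2) = n + 2 :=
      Equiv.swap_apply_of_ne_of_ne (by omega) (by omega)
    simp [permMap, consSeq, tailSeq, this]

lemma xch_apply (p : Pt × I) : xch p = ((p.1.1, consSeq p.2 (tailSeq p.1.2)), p.1.2 0) := rfl

/-! ### `raise` and actions on product dialects inside the microcosm -/

section

variable {ρ : I × I ≃ᵐ I}

lemma rhoMap_apply (p : Pt × I) : rhoMap ρ p =
    ((p.1.1, consSeq (ρ (p.1.2 0, p.1.2 1)) (tailSeq (tailSeq p.1.2))), p.2) := rfl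

lemma raise_apply (p : Pt × I) :
    raise ρ p = ((p.1.1, tailSeq (tailSeq p.1.2)), ρ (p.1.2 0, ρ (p.1.2 1, p.2))) := rfl

variable (ρ) in
/-- `(a, x • s, e) ↦ (a, s, ρ(x, e))`. -/
def absorb : Pt × I ≃ᵐ Pt × I :=
  xch.trans ((permMap (Equiv.swap 0 1)).trans (xch.trans ((rhoMap ρ).trans xch)))

/-- `rhoMap` merges only coordinates of the sequence, so `e` is brought beside `x`, while the
displaced coordinate `s 0` waits in the dialect. -/
lemma absorb_apply (p : Pt × I) :
    absorb ρ p = ((p.1.1, tailSeq p.1.2), ρ (p.1.2 0, p.2)) := by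
  simp only [absorb, MeasurableEquiv.trans_apply, permMap_swap_apply, xch_apply, rhoMap_apply,
    consSeq_zero, consSeq_one, tailSeq_consSeq]
  exact Prod.ext (Prod.ext rfl (consSeq_tailSeq (tailSeq p.1.2))) rfl

lemma absorb_symm_apply (p : Pt × I) :
    (absorb ρ).symm p = ((p.1.1, consSeq (ρ.symm p.2).1 p.1.2), (ρ.symm p.2).2) := by
  rw [MeasurableEquiv.symm_apply_eq, absorb_apply]
  simp

lemma microcosm_absorb : Microcosm ρ (absorb ρ) :=
  .comp .exchange (.comp .perm_swap (.comp .exchange (.comp .rho .exchange)))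

/-- The inner coordinate `y` must be absorbed before `x`, hence the initial transposition. -/
theorem microcosm_raise : Microcosm ρ (raise ρ) := by
  have h : raise ρ =
      (permMap (Equiv.swap 0 1)).trans ((absorb ρ).trans (absorb ρ)) := by
    refine MeasurableEquiv.ext (funext fun p => ?_)
    simp [permMap_swap_apply, absorb_apply, raise_apply]
  rw [h]
  exact .comp .perm_swap (.comp microcosm_absorb microcosm_absorb)

lemma splitL_apply (p : Pt × I) : splitL ρ p = ((p.1, (ρ.symm p.2).1), (ρ.symm p.2).2) := rfl

lemma splitR_apply (p : Pt × I) : splitR ρ p = ((p.1, (ρ.symm p.2).2), (ρ.symm p.2).1) := rfl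

lemma splitL_symm_apply (p : (Pt × I) × I) : (splitL ρ).symm p = (p.1.1, ρ (p.1.2, p.2)) := rfl

lemma splitR_symm_apply (p : (Pt × I) × I) : (splitR ρ).symm p = (p.1.1, ρ (p.2, p.1.2)) := rfl

lemma liftMap_apply (c : Pt × I ≃ᵐ (Pt × I) × I) (φ : Pt × I ≃ᵐ Pt × I) (p : Pt × I) :
    liftMap c φ p = c.symm (φ (c p).1, (c p).2) := rfl

lemma Microcosm.liftMap_splitL {φ : Pt × I ≃ᵐ Pt × I} (h : Microcosm ρ φ) :
    Microcosm ρ (liftMap (splitL ρ) φ) := by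
  -- Every generator but the exchange neither reads nor changes the dialect, so it equals its lift.
  -- The lifted exchange is a transposition performed while `d` is unpacked as a coordinate.
  have aux {φ : Pt × I ≃ᵐ Pt × I} (h : Microcosm ρ φ)
      (h' : ∀ x d d', (φ (x, d)).2 = d ∧ (φ (x, d)).1 = (φ (x, d')).1) :
      Microcosm ρ (liftMap (splitL ρ) φ) := by
    convert h
    refine MeasurableEquiv.ext (funext fun p => Prod.ext ?_ ?_)
    · exact (h' _ _ _).2
    · change ρ ((φ _).2, (ρ.symm p.2).2) = _
      rw [(h' _ _ p.2).1]
      exact (ρ.apply_symm_apply p.2).trans (h' p.1 p.2 p.2).1.symm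
  induction h with
  | one => rw [liftMap_refl]; exact one
  | comp _ _ h1 h2 => rw [liftMap_trans]; exact comp h1 h2
  | affine α l hα => exact aux (affine α l hα) fun _ _ _ => ⟨rfl, rfl⟩
  | perm τ hτ => exact aux (perm τ hτ) fun _ _ _ => ⟨rfl, rfl⟩
  | rho => exact aux rho fun _ _ _ => ⟨rfl, rfl⟩
  | rho_symm => exact aux rho_symm fun _ _ _ => ⟨rfl, rfl⟩
  | exchange =>
    have h : liftMap (splitL ρ) xch =
        (absorb ρ).symm.trans ((permMap (Equiv.swap 0 1)).trans (absorb ρ)) := by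
      refine MeasurableEquiv.ext (funext fun p => ?_)
      simp [permMap_swap_apply, absorb_apply, absorb_symm_apply, liftMap_apply, splitL_apply,
        splitL_symm_apply, xch_apply]
    rw [h]
    exact comp microcosm_absorb.symm (comp perm_swap microcosm_absorb)

lemma Microcosm.liftMap_splitR {φ : Pt × I ≃ᵐ Pt × I} (h : Microcosm ρ φ) :
    Microcosm ρ (liftMap (splitR ρ) φ) := by
  have aux {φ : Pt × I ≃ᵐ Pt × I} (h : Microcosm ρ φ)
      (h' : ∀ x d d', (φ (x, d)).2 = d ∧ (φ (x, d)).1 = (φ (x, d')).1) :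
      Microcosm ρ (liftMap (splitR ρ) φ) := by
    convert h
    refine MeasurableEquiv.ext (funext fun p => Prod.ext ?_ ?_)
    · exact (h' _ _ _).2
    · change ρ ((ρ.symm p.2).1, (φ _).2) = _
      rw [(h' _ _ p.2).1]
      exact (ρ.apply_symm_apply p.2).trans (h' p.1 p.2 p.2).1.symm
  induction h with
  | one => rw [liftMap_refl]; exact one
  | comp _ _ h1 h2 => rw [liftMap_trans]; exact comp h1 h2
  | affine α l hα => exact aux (affine α l hα) fun _ _ _ => ⟨rfl, rfl⟩
  | perm τ hτ => exact aux (perm τ hτ) fun _ _ _ => ⟨rfl, rfl⟩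
  | rho => exact aux rho fun _ _ _ => ⟨rfl, rfl⟩
  | rho_symm => exact aux rho_symm fun _ _ _ => ⟨rfl, rfl⟩
  | exchange =>
    -- Unpacking releases the component that must stay fixed, so it is moved out of the first slot
    -- before the exchange and moved back afterwards.
    have h : liftMap (splitR ρ) xch =
        (absorb ρ).symm.trans ((permMap (Equiv.swap 0 1)).trans
          (xch.trans ((permMap (Equiv.swap 0 1)).trans (absorb ρ)))) := by
      refine MeasurableEquiv.ext (funext fun p => ?_)
      simp [permMap_swap_apply, absorb_apply, absorb_symm_apply, liftMap_apply, splitR_apply,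
        splitR_symm_apply, xch_apply]
    rw [h]
    exact comp microcosm_absorb.symm (comp perm_swap (comp exchange (comp perm_swap
      microcosm_absorb)))

lemma microcosm_pathRealiser {E : Type} {rel : E → (Pt × I ≃ᵐ Pt × I)}
    (h : ∀ e, Microcosm ρ (rel e)) : ∀ π, Microcosm ρ (Graphing.pathRealiser rel π)
  | [] => .one
  | e :: π => .comp (h e) (microcosm_pathRealiser h π)

lemma microcosm_pairRealiser {Ω : Type*} {F G : Graphing Ω} (hF : F.InMicrocosm ρ)
    (hG : G.InMicrocosm ρ) (e : F.Edge ⊕ G.Edge) : Microcosm ρ (Graphing.pairRealiser ρ F G e) :=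
  match e with
  | .inl e => (hF e).liftMap_splitL
  | .inr e => (hG e).liftMap_splitR

end

/-! ### Transfer of the measurement along a measure-preserving map -/

/-- The minimal period is determined by which iterates fix the point, a countable family of closed
conditions on `k`; the value `0` for aperiodic points fits, as `0` divides only `0`. -/
lemma measurable_minimalPeriod {α : Type*} [MeasurableSpace α] [MeasurableEq α] {f : α → α}
    (hf : Measurable f) : Measurable (Function.minimalPeriod f) := by
  refine measurable_to_countable' fun n => ?_
  have h : Function.minimalPeriod f ⁻¹' {n} =
      ⋂ k : ℕ, {x | f^[k] x = x ↔ n ∣ k} := by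
    ext x
    simp only [mem_preimage, mem_singleton_iff, mem_iInter, mem_ofPred_eq]
    have key k : f^[k] x = x ↔ Function.minimalPeriod f x ∣ k :=
      Function.isPeriodicPt_iff_minimalPeriod_dvd
    simp only [key]
    exact ⟨fun h k => by rw [h], fun h => Nat.dvd_antisymm ((h n).2 dvd_rfl) ((h _).1 dvd_rfl)⟩
  rw [h]
  refine MeasurableSet.iInter fun k => ?_
  have hk : MeasurableSet {x | f^[k] x = x} := measurableSet_eq_fun (hf.iterate k) measurable_id
  by_cases h : n ∣ k
  · simpa [h] using hk
  · simp only [h, iff_false]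
    exact hk.compl

namespace Graphing

variable {Ω : Type*} {ρ : I × I ≃ᵐ I}

lemma measurableSet_circuitSupport (F G : Graphing Ω) (π : List (F.Edge ⊕ G.Edge)) :
    MeasurableSet (circuitSupport ρ F G π) := by
  have hm := (pathRealiser (pairRealiser ρ F G) π).measurable
  have h : circuitSupport ρ F G π =
      Function.minimalPeriod (pathRealiser (pairRealiser ρ F G) π) ⁻¹' {0}ᶜ ∩
      ⋂ n : ℕ, (pathRealiser (pairRealiser ρ F G) π)^[n] ⁻¹'
        pathSource (pairSource ρ F G) (pairRealiser ρ F G) π := by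
    ext p
    simp only [circuitSupport, mem_ofPred_eq, mem_inter_iff, mem_preimage, mem_compl_iff,
      mem_singleton_iff, mem_iInter, ← Function.minimalPeriod_pos_iff_mem_periodicPts,
      Nat.pos_iff_ne_zero]
  rw [h]
  exact (measurable_minimalPeriod hm (measurableSet_singleton _).compl).inter
    (.iInter fun n => hm.iterate n
      (measurableSet_pathSource (measurableSet_pairSource ρ F G) π))

lemma circuitMeas_eq_zero [Monoid Ω] {m : Ω → ℝ≥0∞} {F G : Graphing Ω}
    {π : List (F.Edge ⊕ G.Edge)} (h : muXI (circuitSupport ρ F G π) = 0) :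
    circuitMeas ρ m F G π = 0 :=
  setLIntegral_measure_zero _ _ h

lemma pathSource_append {E : Type} {src : E → Set (Pt × I)} {rel : E → (Pt × I ≃ᵐ Pt × I)}
    (π π' : List E) : pathSource src rel (π ++ π') =
      pathSource src rel π ∩ pathRealiser rel π ⁻¹' pathSource src rel π' := by
  induction π with
  | nil => exact (univ_inter _).symm
  | cons e π ih =>
    rw [List.cons_append, pathSource, ih, preimage_inter, pathSource, inter_assoc]
    rfl

/-- A path through an edge of negligible source has a negligible source. -/
lemma pathSource_null {E : Type} {src : E → Set (Pt × I)} {rel : E → (Pt × I ≃ᵐ Pt × I)}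
    (hrel : ∀ e, Measure.QuasiMeasurePreserving (rel e) muXI muXI) {e : E}
    (he : muXI (src e) = 0) : ∀ {π : List E}, e ∈ π → muXI (pathSource src rel π) = 0
  | e' :: π, h => by
    rcases List.mem_cons.1 h with rfl | h
    · exact measure_mono_null inter_subset_left he
    · exact measure_mono_null inter_subset_right ((hrel e').preimage_null
        (pathSource_null hrel he h))

lemma isCircuit_map_iff {E E' K K' : Type} {f : E → K} {g : E' → K'} (hf : f.Injective)
    (hg : g.Injective) (π : List (E ⊕ E')) :
    IsCircuit (π.map (Sum.map f g)) ↔ IsCircuit π := by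
  have hj : (Sum.map f g).Injective := hf.sumMap hg
  have hA (a b : E ⊕ E') : Alternate (Sum.map f g a) (Sum.map f g b) ↔ Alternate a b := by
    simp [Alternate]
  unfold IsCircuit
  refine and_congr (by simp) (and_congr ?_ ?_)
  · rw [← Cycle.map_coe, Cycle.chain_map]
    simp only [hA]
  · constructor
    · intro h l k hk
      refine h (l.map (Sum.map f g)) k ?_
      rw [hk, List.map_flatten, List.map_replicate]
    · intro h l k hk
      -- For `k = 0` nothing constrains the letters of `l`, so it cannot be pulled back; the empty
      -- list serves instead.
      rcases k with _ | k
      · have : π = [] := by simpa using hk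
        exact h [] 0 (by simp [this])
      · have hl : ∀ x ∈ l, x ∈ range (Sum.map f g) := by
          intro x hx
          have : x ∈ π.map (Sum.map f g) := by
            rw [hk, List.replicate_succ, List.flatten_cons]
            exact List.mem_append_left _ hx
          obtain ⟨y, _, rfl⟩ := List.mem_map.1 this
          exact mem_range_self y
        obtain ⟨l', rfl⟩ : l ∈ range (List.map (Sum.map f g)) := by
          rw [Set.range_list_map]
          exact hl
        refine h l' (k + 1) (hj.list_map ?_)
        rw [hk, List.map_flatten, List.map_replicate]

section Transfer

variable {F G F' G' : Graphing Ω} {f : F'.Edge → F.Edge}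
  {g : G'.Edge → G.Edge} {T : Pt × I → Pt × I} {Z : Type*} {z : Pt × I → Z}

/-- The pair `F, G` restricted to the edges in the image of `F', G'` is, through `T`, the product
of the pair `F', G'` with an idle component `z`. -/
structure Factors (ρ : I × I ≃ᵐ I) (f : F'.Edge → F.Edge) (g : G'.Edge → G.Edge)
    (T : Pt × I → Pt × I) (z : Pt × I → Z) : Prop where
  source : ∀ e p, p ∈ pairSource ρ F G (Sum.map f g e) ↔ T p ∈ pairSource ρ F' G' e
  realiser : ∀ e p, T (pairRealiser ρ F G (Sum.map f g e) p) = pairRealiser ρ F' G' e (T p)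
  idle : ∀ e p, z (pairRealiser ρ F G (Sum.map f g e) p) = z p
  weight : ∀ e, pairWeight F G (Sum.map f g e) = pairWeight F' G' e
  ext : ∀ p q, T p = T q → z p = z q → p = q

namespace Factors

variable (h : Factors ρ f g T z)
include h

lemma pathRealiser (π : List (F'.Edge ⊕ G'.Edge)) (p : Pt × I) :
    T (Graphing.pathRealiser (pairRealiser ρ F G) (π.map (Sum.map f g)) p) =
      Graphing.pathRealiser (pairRealiser ρ F' G') π (T p) ∧
    z (Graphing.pathRealiser (pairRealiser ρ F G) (π.map (Sum.map f g)) p) = z p := by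
  induction π generalizing p with
  | nil => exact ⟨rfl, rfl⟩
  | cons e π ih =>
    obtain ⟨h1, h2⟩ := ih (pairRealiser ρ F G (Sum.map f g e) p)
    exact ⟨h1.trans (congrArg _ (h.realiser e p)), h2.trans (h.idle e p)⟩

lemma pathSource (π : List (F'.Edge ⊕ G'.Edge)) (p : Pt × I) :
    p ∈ Graphing.pathSource (pairSource ρ F G) (pairRealiser ρ F G) (π.map (Sum.map f g)) ↔
      T p ∈ Graphing.pathSource (pairSource ρ F' G') (pairRealiser ρ F' G') π := by
  induction π generalizing p with
  | nil => exact Iff.rfl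
  | cons e π ih =>
    refine and_congr (h.source e p) ?_
    rw [mem_preimage, mem_preimage, ← h.realiser]
    exact ih _

lemma pathWeight [Monoid Ω] (π : List (F'.Edge ⊕ G'.Edge)) :
    Graphing.pathWeight (pairWeight F G) (π.map (Sum.map f g)) =
      Graphing.pathWeight (pairWeight F' G') π := by
  induction π with
  | nil => rfl
  | cons e π ih => rw [List.map_cons, Graphing.pathWeight, Graphing.pathWeight, ih, h.weight]

lemma iterate (π : List (F'.Edge ⊕ G'.Edge)) (n : ℕ) (p : Pt × I) :
    T ((Graphing.pathRealiser (pairRealiser ρ F G) (π.map (Sum.map f g)))^[n] p) =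
      (Graphing.pathRealiser (pairRealiser ρ F' G') π)^[n] (T p) ∧
    z ((Graphing.pathRealiser (pairRealiser ρ F G) (π.map (Sum.map f g)))^[n] p) = z p := by
  induction n generalizing p with
  | zero => exact ⟨rfl, rfl⟩
  | succ n ih =>
    simp only [Function.iterate_succ_apply]
    rw [(ih _).1, (ih _).2, (h.pathRealiser π p).1, (h.pathRealiser π p).2]
    exact ⟨rfl, rfl⟩

/-- The idle component never moves, so a return of `T p` is already a return of `p`, by joint
injectivity of `T` and `z`. -/
lemma minimalPeriod (π : List (F'.Edge ⊕ G'.Edge)) (p : Pt × I) :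
    Function.minimalPeriod (Graphing.pathRealiser (pairRealiser ρ F G) (π.map (Sum.map f g))) p =
      Function.minimalPeriod (Graphing.pathRealiser (pairRealiser ρ F' G') π) (T p) := by
  refine Function.minimalPeriod_eq_minimalPeriod_iff.2 fun n => ?_
  obtain ⟨h1, h2⟩ := h.iterate π n p
  exact ⟨fun hp => h1.symm.trans (congrArg T hp), fun hp => h.ext _ _ (h1.trans hp) h2⟩

lemma circuitSupport (π : List (F'.Edge ⊕ G'.Edge)) :
    Graphing.circuitSupport ρ F G (π.map (Sum.map f g)) =
      T ⁻¹' Graphing.circuitSupport ρ F' G' π := by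
  ext p
  simp only [Graphing.circuitSupport, mem_preimage, mem_ofPred_eq,
    ← Function.minimalPeriod_pos_iff_mem_periodicPts, h.minimalPeriod, h.pathSource,
    (h.iterate π _ p).1]

lemma circuitMeas [Monoid Ω] {m : Ω → ℝ≥0∞} (hT : MeasurePreserving T muXI muXI)
    (π : List (F'.Edge ⊕ G'.Edge)) :
    Graphing.circuitMeas ρ m F G (π.map (Sum.map f g)) = Graphing.circuitMeas ρ m F' G' π := by
  have hN := measurable_minimalPeriod
    (Graphing.pathRealiser (pairRealiser ρ F' G') π).measurable
  simp only [Graphing.circuitMeas, h.circuitSupport, h.minimalPeriod, h.pathWeight]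
  -- The integrand depends on the point only through its period, so it is measurable for any `m`.
  exact hT.setLIntegral_comp_preimage (measurableSet_circuitSupport F' G' π)
    ((measurable_from_nat (f := fun n : ℕ =>
      m (Graphing.pathWeight (pairWeight F' G') π ^ n) / (n : ℝ≥0∞))).comp hN)

/-- Two pairs of graphings related by a measure-preserving map have the same measurement. -/
theorem meas [Monoid Ω] {m : Ω → ℝ≥0∞} (hT : MeasurePreserving T muXI muXI)
    (hf : f.Injective) (hg : g.Injective)
    (hnull : ∀ π : List (F.Edge ⊕ G.Edge), (∃ e ∈ π, e ∉ range (Sum.map f g)) →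
      muXI (Graphing.pathSource (pairSource ρ F G) (pairRealiser ρ F G) π) = 0) :
    Graphing.meas ρ m F G = Graphing.meas ρ m F' G' := by
  let i : {π : List (F'.Edge ⊕ G'.Edge) // IsCircuit π} →
      {π : List (F.Edge ⊕ G.Edge) // IsCircuit π} :=
    fun π => ⟨π.1.map (Sum.map f g), (isCircuit_map_iff hf hg _).2 π.2⟩
  have hi : i.Injective := fun π π' hπ =>
    Subtype.ext ((hf.sumMap hg).list_map (congrArg Subtype.val hπ))
  unfold Graphing.meas
  rw [← hi.tsum_eq]
  · refine tsum_congr fun π => ?_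
    simp only [i, h.circuitMeas hT, List.length_map]
  -- A circuit not coming from `F', G'` uses an edge outside the range, so its support is negligible
  -- by `hnull`.
  · rintro ⟨π, hπ⟩ hne
    by_contra hr
    refine hne ?_
    have : ∃ e ∈ π, e ∉ range (Sum.map f g) := by
      by_contra hcon
      push Not at hcon
      obtain ⟨π', rfl⟩ : π ∈ range (List.map (Sum.map f g)) := by
        rw [Set.range_list_map]
        exact hcon
      exact hr ⟨⟨π', (isCircuit_map_iff hf hg _).1 hπ⟩, rfl⟩
    simp only
    rw [circuitMeas_eq_zero (measure_mono_null (fun p hp => hp.2 0) (hnull π this)),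
      ENNReal.zero_div]

end Factors

end Transfer

end Graphing

/-! ### Rearrangements of dialects, and execution against a fax -/

section

variable {ρ : I × I ≃ᵐ I}

lemma measurePreserving_splitR (hρ : MeasurePreserving ρ volume volume) :
    MeasurePreserving (splitR ρ) muXI (muXI.prod volume) :=
  measurePreserving_splitL (hρ.comp Measure.measurePreserving_swap)

lemma measurePreserving_liftMap {c : Pt × I ≃ᵐ (Pt × I) × I}
    (hc : MeasurePreserving c muXI (muXI.prod volume)) {φ : Pt × I ≃ᵐ Pt × I}
    (hφ : MeasurePreserving φ muXI muXI) : MeasurePreserving (liftMap c φ) muXI muXI :=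
  hc.symm.comp ((measurePreserving_prodMap hφ (MeasurePreserving.id volume)).comp hc)

lemma measurePreserving_push2_symm :
    MeasurePreserving push2.symm muX (muXI.prod volume) :=
  (measurePreserving_prod_right_comm muX volume volume).comp
    ((measurePreserving_prodMap measurePreserving_push.symm (MeasurePreserving.id volume)).comp
      measurePreserving_push.symm)

variable (ρ) in
/-- `ρ(b, ρ(d, c)) ↦ ρ(ρ(d, b), c)`. -/
def reassoc : I ≃ᵐ I :=
  ρ.symm.trans (((MeasurableEquiv.refl I).prodCongr ρ.symm).trans
    (MeasurableEquiv.prodAssoc.symm.trans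
      ((MeasurableEquiv.prodComm.prodCongr (MeasurableEquiv.refl I)).trans
        ((ρ.prodCongr (MeasurableEquiv.refl I)).trans ρ))))

lemma reassoc_apply (b d c : I) : reassoc ρ (ρ (b, ρ (d, c))) = ρ (ρ (d, b), c) := by
  change ρ (ρ ((ρ.symm (ρ.symm (ρ (b, ρ (d, c)))).2).1, (ρ.symm (ρ (b, ρ (d, c)))).1),
    (ρ.symm (ρ.symm (ρ (b, ρ (d, c)))).2).2) = _
  simp

lemma measurePreserving_reassoc (hρ : MeasurePreserving ρ volume volume) :
    MeasurePreserving (reassoc ρ) volume volume := by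
  have hid := MeasurePreserving.id (volume : Measure I)
  have hρ' : MeasurePreserving ρ.symm volume (volume.prod volume) := hρ.symm
  exact hρ.comp ((measurePreserving_prodMap hρ hid).comp ((measurePreserving_prodMap
    Measure.measurePreserving_swap hid).comp ((measurePreserving_prodAssoc _ _ _).symm.comp
      ((measurePreserving_prodMap hid hρ').comp hρ'))))

lemma exists_eq_apply_pair (x : I) : ∃ a b, x = ρ (a, b) :=
  ⟨(ρ.symm x).1, (ρ.symm x).2, (ρ.apply_symm_apply x).symm⟩

lemma symmDiff_union_self_left {α : Type*} {U W : Set α} (hd : Disjoint U W) :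
    symmDiff (U ∪ W) U = W := by
  rw [Set.symmDiff_def, union_sdiff_left, sdiff_eq_empty.2 subset_union_left, union_empty]
  exact hd.symm.sdiff_eq_left

namespace Graphing

variable {Ω : Type*} {U W : Set Pt} {B : Pt × I ≃ᵐ Pt × I}

lemma pairSource_inr {F G : Graphing Ω} {b : G.Edge} {p : Pt × I}
    (h : p ∈ pairSource ρ F G (.inr b)) : p.1 ∈ G.support :=
  ((G.idTimes ρ).source_subset b h).1

lemma pairRealiser_inr {F G : Graphing Ω} {b : G.Edge} {p : Pt × I}
    (h : p ∈ pairSource ρ F G (.inr b)) : (pairRealiser ρ F G (.inr b) p).1 ∈ G.support :=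
  ((G.idTimes ρ).mapsTo b h).1

/-! ### The fax along a Borel automorphism -/

lemma mem_iff_symm (hB : ∀ p, p.1 ∈ U ↔ (B p).1 ∈ W) (p : Pt × I) :
    p.1 ∈ W ↔ (B.symm p).1 ∈ U := by
  rw [hB, B.apply_symm_apply]

/-- The graphing exchanging `U × [0,1]` and `W × [0,1]` along `B`. -/
def fax [Monoid Ω] (B : Pt × I ≃ᵐ Pt × I) (hU : MeasurableSet U) (hW : MeasurableSet W)
    (hB : ∀ p, p.1 ∈ U ↔ (B p).1 ∈ W) : Graphing Ω where
  support := U ∪ W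
  measurableSet_support := hU.union hW
  Edge := Bool
  source e := (bif e then U else W) ×ˢ univ
  measurableSet_source e := by cases e <;> exact MeasurableSet.prod ‹_› .univ
  source_subset e := by
    cases e
    · exact prod_mono_left subset_union_right
    · exact prod_mono_left subset_union_left
  realiser e := bif e then B else B.symm
  mapsTo e p hp := by
    cases e
    · exact ⟨Or.inl ((mem_iff_symm hB p).1 hp.1), mem_univ _⟩
    · exact ⟨Or.inr ((hB p).1 hp.1), mem_univ _⟩
  weight _ := 1

/-- The transport of `Id_[0,1] × G` along `B`, acting on the first component of the dialect. -/
def relocate (ρ : I × I ≃ᵐ I) (G : Graphing Ω) (B : Pt × I ≃ᵐ Pt × I) (hW : MeasurableSet W)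
    (hB : ∀ p, p.1 ∈ U ↔ (B p).1 ∈ W) (hG : G.support = U) : Graphing Ω :=
  (G.idTimes ρ).map (liftMap (splitL ρ) B) W hW fun p => by
    change p.1 ∈ G.support ↔ _
    rw [hG]
    exact hB (splitL ρ p).1

lemma measure_relocate_source (hρ : MeasurePreserving ρ volume volume)
    (hBm : MeasurePreserving B muXI muXI) {hW : MeasurableSet W}
    {hB : ∀ p, p.1 ∈ U ↔ (B p).1 ∈ W} {G : Graphing Ω} (hG : G.support = U) (b : G.Edge) :
    muXI ((relocate ρ G B hW hB hG).source b) = muXI (G.source b) :=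
  (measurePreserving_fst.comp ((measurePreserving_splitR hρ).comp
    (measurePreserving_liftMap (measurePreserving_splitL hρ) hBm).symm)).measure_preimage
    (G.measurableSet_source b).nullMeasurableSet

section

variable [Monoid Ω] {hU : MeasurableSet U} {hW : MeasurableSet W}
  {hB : ∀ p, p.1 ∈ U ↔ (B p).1 ∈ W} {G : Graphing Ω}

local notation "𝔽" => fax (Ω := Ω) B hU hW hB

lemma pairSource_fax_true {p : Pt × I} :
    p ∈ pairSource ρ 𝔽 G (.inl true) ↔ p.1 ∈ U := by
  change p.1 ∈ U ∧ True ↔ _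
  simp

lemma pairSource_fax_false {p : Pt × I} :
    p ∈ pairSource ρ 𝔽 G (.inl false) ↔ p.1 ∈ W := by
  change p.1 ∈ W ∧ True ↔ _
  simp

lemma pairRealiser_fax_true {p : Pt × I} :
    (pairRealiser ρ 𝔽 G (.inl true) p).1 ∈ W ↔ p.1 ∈ U :=
  (hB (splitL ρ p).1).symm

lemma pairRealiser_fax_false {p : Pt × I} :
    (pairRealiser ρ 𝔽 G (.inl false) p).1 ∈ U ↔ p.1 ∈ W :=
  (mem_iff_symm hB (splitL ρ p).1).symm

lemma not_mem_pathSource_true_inr (hd : Disjoint U W) (hG : G.support = U) {b : G.Edge}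
    {π : List (Bool ⊕ G.Edge)} {p : Pt × I} :
    p ∉ pathSource (pairSource ρ 𝔽 G) (pairRealiser ρ 𝔽 G) (.inl true :: .inr b :: π) := by
  rintro ⟨h1, h2, -⟩
  have h3 := pairSource_inr h2
  rw [hG] at h3
  exact disjoint_left.1 hd h3 (pairRealiser_fax_true.2 (pairSource_fax_true.1 h1))

lemma not_mem_pathSource_inr_false (hd : Disjoint U W) (hG : G.support = U) {b : G.Edge}
    {π : List (Bool ⊕ G.Edge)} {p : Pt × I} :
    p ∉ pathSource (pairSource ρ 𝔽 G) (pairRealiser ρ 𝔽 G) (.inr b :: .inl false :: π) := by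
  rintro ⟨h1, h2, -⟩
  have h3 := pairRealiser_inr h1
  rw [hG] at h3
  exact disjoint_left.1 hd h3 (pairSource_fax_false.1 h2)

/-- An alternating path of length at least four between `𝔽` and `G` has an empty domain. -/
lemma not_mem_pathSource_of_length (hd : Disjoint U W) (hG : G.support = U) {p : Pt × I} :
    ∀ {π : List (Bool ⊕ G.Edge)}, π.IsChain Alternate → 4 ≤ π.length →
      p ∉ pathSource (pairSource ρ 𝔽 G) (pairRealiser ρ 𝔽 G) π
  | a :: b :: c :: d :: π, hc, _, hp => by
    simp only [List.isChain_cons_cons, Alternate] at hc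
    -- Among four alternating edges some fax edge sits between two edges of `G`: if it is `false`
    -- its predecessor is impossible, if it is `true` its successor is.
    rcases a with a | a
    · rcases b with b | b
      · simp at hc
      rcases c with (_ | _) | c
      · exact not_mem_pathSource_inr_false hd hG hp.2
      · rcases d with d | d
        · simp at hc
        · exact not_mem_pathSource_true_inr hd hG hp.2.2
      · simp at hc
    · rcases b with (_ | _) | b
      · exact not_mem_pathSource_inr_false hd hG hp
      · rcases c with c | c
        · simp at hc
        · exact not_mem_pathSource_true_inr hd hG hp.2
      · simp at hc

/-- A point in the support of a circuit can run through it twice. Alternation forces at least two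
edges, so the doubled path has at least four and an empty domain. -/
lemma meas_fax (m : Ω → ℝ≥0∞) (hd : Disjoint U W) (hG : G.support = U) :
    meas ρ m 𝔽 G = 0 := by
  refine ENNReal.tsum_eq_zero.2 fun ⟨π, hne, hc, _⟩ => ?_
  rw [circuitMeas_eq_zero, ENNReal.zero_div]
  refine measure_mono_null (fun p hp => ?_) measure_empty
  obtain ⟨a, l, rfl⟩ := List.exists_cons_of_ne_nil hne
  rw [Cycle.chain_coe_cons, ← List.cons_append] at hc
  obtain ⟨h1, -, h2⟩ := List.isChain_append.1 hc
  refine absurd ?_ (not_mem_pathSource_of_length (ρ := ρ) (hU := hU) (hW := hW) (hB := hB) (p := p)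
    (π := (a :: l) ++ (a :: l)) hd hG (List.isChain_append.2 ⟨h1, h1, h2⟩) ?_)
  · rw [pathSource_append]
    exact ⟨hp.2 0, hp.2 1⟩
  · rcases l with _ | ⟨b, l⟩
    · simp [Alternate] at h2
    · have h4 : 4 ≤ ((a :: b :: l) ++ (a :: b :: l)).length := by
        simp only [List.length_append, List.length_cons]
        omega
      exact h4

/-- The cut is `U`. A transported edge starts and ends in `W`, so the restriction to the complement
of the cut removes nothing. -/
lemma hiddenSource_fax (hd : Disjoint U W) (hG : G.support = U) (b : G.Edge) :
    hiddenSource ρ 𝔽 G [.inl false, .inr b, .inl true] = (relocate ρ G B hW hB hG).source b := by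
  have hcut : (𝔽).support ∩ G.support = U := by
    rw [hG]
    exact union_inter_cancel_left
  ext p
  unfold hiddenSource
  rw [hcut]
  constructor
  · exact fun h => h.1.2.1
  · intro h
    have hp := ((relocate ρ G B hW hB hG).source_subset b h).1
    have hp' := ((relocate ρ G B hW hB hG).mapsTo b h).1
    refine ⟨⟨pairSource_fax_false.2 hp, h, ?_, trivial⟩, disjoint_right.1 hd hp,
      disjoint_right.1 hd hp'⟩
    have := pairRealiser_inr (F := 𝔽) (G := G) (b := b) h
    rw [hG] at this
    exact pairSource_fax_true.2 this

/-- Starting outside `U` forces the first edge to be `false`. The path is then in `U` and must leave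
it, which only `true` achieves, after one edge of `G`; any continuation has length four. -/
lemma exists_eq_of_hiddenSource (hd : Disjoint U W) (hG : G.support = U)
    {π : List (Bool ⊕ G.Edge)} (hne : π ≠ []) (hc : π.IsChain Alternate) {p : Pt × I}
    (hp : p ∈ hiddenSource ρ 𝔽 G π) : ∃ b, [.inl false, .inr b, .inl true] = π := by
  have hcut : (𝔽).support ∩ G.support = U := by
    rw [hG]
    exact union_inter_cancel_left
  unfold hiddenSource at hp
  rw [hcut] at hp
  obtain ⟨hs, h0, h1⟩ := hp
  rcases π with _ | ⟨a, π⟩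
  · exact absurd rfl hne
  rcases a with (_ | _) | b
  · rcases π with _ | ⟨b, π⟩
    · exact absurd ((pairRealiser_fax_false (G := G)).2 (pairSource_fax_false.1 hs.1)) h1
    rcases b with b | b
    · simp [Alternate] at hc
    rcases π with _ | ⟨c, π⟩
    · have := pairRealiser_inr hs.2.1
      rw [hG] at this
      exact absurd this h1
    rcases c with (_ | _) | c
    · exact absurd hs.2 (not_mem_pathSource_inr_false hd hG)
    · rcases π with _ | ⟨d, π⟩
      · exact ⟨b, rfl⟩
      · exact absurd hs (not_mem_pathSource_of_length hd hG hc (by simp))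
    · simp [Alternate] at hc
  · exact absurd (pairSource_fax_true.1 hs.1) h0
  · exact absurd (hG.subset (pairSource_inr hs.1)) h0

/-- The edges of `𝔽 :: G`. -/
noncomputable def execFaxEdge (hd : Disjoint U W) (hG : G.support = U) :
    {b : G.Edge // muXI ((relocate ρ G B hW hB hG).source b) ≠ 0} ≃
      (exec ρ 𝔽 G).Edge :=
  Equiv.ofBijective (fun b => ⟨[.inl false, .inr b.1, .inl true], by simp,
      by simpa [Alternate] using ⟨rfl, rfl⟩, by
      rw [hiddenSource_fax hd hG]
      exact b.2⟩)
    ⟨fun b b' h => Subtype.ext (by simpa using congrArg Subtype.val h), fun ⟨π, hne, hc, hπ⟩ => by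
      obtain ⟨p, hp⟩ := nonempty_of_measure_ne_zero hπ
      obtain ⟨b, rfl⟩ := exists_eq_of_hiddenSource hd hG hne hc hp
      exact ⟨⟨b, by rwa [← hiddenSource_fax hd hG]⟩, rfl⟩⟩

lemma weight_execFaxEdge (hd : Disjoint U W) (hG : G.support = U)
    (b : {b : G.Edge // muXI ((relocate ρ G B hW hB hG).source b) ≠ 0}) :
    (exec ρ 𝔽 G).weight (execFaxEdge hd hG b) = G.weight b.1 := by
  change 1 * 1 * G.weight b.1 * 1 = _
  simp

lemma source_execFaxEdge (hd : Disjoint U W) (hG : G.support = U)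
    (b : {b : G.Edge // muXI ((relocate ρ G B hW hB hG).source b) ≠ 0}) :
    (exec ρ 𝔽 G).source (execFaxEdge hd hG b) = (relocate ρ G B hW hB hG).source b.1 :=
  hiddenSource_fax hd hG b.1

lemma realiser_execFaxEdge (hd : Disjoint U W) (hG : G.support = U)
    (b : {b : G.Edge // muXI ((relocate ρ G B hW hB hG).source b) ≠ 0}) :
    (exec ρ 𝔽 G).realiser (execFaxEdge hd hG b) = (relocate ρ G B hW hB hG).realiser b.1 := rfl

lemma aeEq_exec_fax (hd : Disjoint U W) (hG : G.support = U) {H : Graphing Ω}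
    (hH : H.support = W) (ε : G.Edge ≃ H.Edge) (hw : ∀ b, G.weight b = H.weight (ε b))
    (hs : ∀ b, (relocate ρ G B hW hB hG).source b = H.source (ε b))
    (hr : ∀ b p, (relocate ρ G B hW hB hG).realiser b p = H.realiser (ε b) p) :
    (exec ρ 𝔽 G).AEEq H := by
  let E : {π : (exec ρ 𝔽 G).Edge // muXI ((exec ρ 𝔽 G).source π) ≠ 0} ≃
      {h : H.Edge // muXI (H.source h) ≠ 0} :=
    (Equiv.subtypeUnivEquiv fun π => π.2.2.2).trans ((execFaxEdge hd hG).symm.trans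
      (ε.subtypeEquiv fun b => not_congr (by rw [← hs b])))
  have hE b (hπ : muXI ((exec ρ 𝔽 G).source (execFaxEdge hd hG b)) ≠ 0) :
      (E ⟨execFaxEdge hd hG b, hπ⟩).1 = ε b.1 := by
    change ε ((execFaxEdge hd hG).symm (execFaxEdge hd hG b)).1 = _
    rw [Equiv.symm_apply_apply]
  refine ⟨?_, E, ?_⟩
  · change symmDiff (U ∪ W) G.support = H.support
    rw [hG, hH, symmDiff_union_self_left hd]
  · rintro ⟨π, hπ⟩
    obtain ⟨b, rfl⟩ := (execFaxEdge hd hG).surjective π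
    rw [hE, weight_execFaxEdge, source_execFaxEdge, realiser_execFaxEdge]
    exact ⟨hw _, (hs b.1).eventuallyEq, .of_forall fun p _ => hr b.1 p⟩

end

end Graphing

end

/-! ### Raising to another support -/

section

variable {ρ : I × I ≃ᵐ I}

/-- `(a, s, e) ↦ θ(raise(a, s, e))`. -/
def raiseTo (ρ : I × I ≃ᵐ I) (θ : Pt ≃ᵐ Pt) : Pt × I ≃ᵐ Pt × I :=
  (raise ρ).trans (timesIdMap θ)

/-- This is where raising undoes perennisation: the stored dialect `q.2` becomes the first component
of the dialect, and the fresh slot `w` joins the idle remainder. -/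
lemma raiseTo_apply_push2 (θ : Pt ≃ᵐ Pt) (q : Pt × I) (w e : I) :
    raiseTo ρ θ (push2 (q, w), e) = (θ q.1, ρ (q.2, ρ (w, e))) := rfl

lemma raiseTo_symm_apply (θ : Pt ≃ᵐ Pt) (x : Pt) (d w e : I) :
    (raiseTo ρ θ).symm (x, ρ (d, ρ (w, e))) = (push2 ((θ.symm x, d), w), e) := by
  rw [MeasurableEquiv.symm_apply_eq, raiseTo_apply_push2]
  simp

lemma mem_bangSupport_iff_raiseTo {V : Set Pt} {θ : Pt ≃ᵐ Pt} (p : Pt × I) :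
    p.1 ∈ bangSupport V ↔ (raiseTo ρ θ p).1 ∈ θ '' V := by
  obtain ⟨x, e⟩ := p
  obtain ⟨⟨q, w⟩, rfl⟩ := push2.surjective x
  rw [raiseTo_apply_push2, θ.injective.mem_set_image, bangSupport, mem_preimage,
    push2.symm_apply_apply]
  simp

end

namespace Graphing

/-! ### Adjunction -/

variable {Ω : Type*} {ρ : I × I ≃ᵐ I} {U W : Set Pt} {B : Pt × I ≃ᵐ Pt × I}
  {hU : MeasurableSet U} {hW : MeasurableSet W} {hB : ∀ p, p.1 ∈ U ↔ (B p).1 ∈ W}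
  {G C : Graphing Ω}

/-- In the dialect `ρ (d, e)` of a relocated graphing, `d` serves the change of place `B` and `e`
serves `G`. -/
lemma mem_source_relocate (hG : G.support = U) {b : G.Edge} {x : Pt} {d e : I} :
    (x, ρ (d, e)) ∈ (relocate ρ G B hW hB hG).source b ↔
      ((B.symm (x, d)).1, e) ∈ G.source b := by
  change ((B.symm (x, (ρ.symm (ρ (d, e))).1)).1, (ρ.symm (ρ ((B.symm (x, (ρ.symm (ρ (d, e))).1)).2,
    (ρ.symm (ρ (d, e))).2))).2) ∈ G.source b ↔ _
  simp

lemma realiser_relocate_apply (hG : G.support = U) (b : G.Edge) (x : Pt) (d e : I) :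
    (relocate ρ G B hW hB hG).realiser b (x, ρ (d, e)) =
      (liftMap (splitL ρ) B) ((G.realiser b ((B.symm (x, d)).1, e)).1,
        ρ ((B.symm (x, d)).2, (G.realiser b ((B.symm (x, d)).1, e)).2)) := by
  change liftMap (splitL ρ) B ((splitR ρ).symm (G.realiser b (splitR ρ
    ((splitL ρ).symm (B.symm (splitL ρ (x, ρ (d, e))).1, (splitL ρ (x, ρ (d, e))).2))).1, 
    (splitR ρ ((splitL ρ).symm (B.symm (splitL ρ (x, ρ (d, e))).1,
      (splitL ρ (x, ρ (d, e))).2))).2)) = _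
  simp [splitL_apply, splitR_apply, splitL_symm_apply, splitR_symm_apply]

lemma liftMap_splitL_apply (φ : Pt × I ≃ᵐ Pt × I) (x : Pt) (d e : I) :
    liftMap (splitL ρ) φ (x, ρ (d, e)) = ((φ (x, d)).1, ρ ((φ (x, d)).2, e)) := by
  simp [liftMap_apply, splitL_apply, splitL_symm_apply]

lemma liftMap_splitR_apply (φ : Pt × I ≃ᵐ Pt × I) (x : Pt) (d e : I) :
    liftMap (splitR ρ) φ (x, ρ (d, e)) = ((φ (x, e)).1, ρ (d, (φ (x, e)).2)) := by
  simp [liftMap_apply, splitR_apply, splitR_symm_apply]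

lemma mem_pairSource_inl {b : G.Edge} {x : Pt} {d e : I} :
    (x, ρ (d, e)) ∈ pairSource ρ G C (.inl b) ↔ (x, d) ∈ G.source b := by
  change (splitL ρ (x, ρ (d, e))).1 ∈ G.source b ↔ _
  simp [splitL_apply]

lemma mem_pairSource_inr {b : C.Edge} {x : Pt} {d e : I} :
    (x, ρ (d, e)) ∈ pairSource ρ G C (.inr b) ↔ (x, e) ∈ C.source b := by
  change (splitR ρ (x, ρ (d, e))).1 ∈ C.source b ↔ _
  simp [splitR_apply]

lemma pairRealiser_inl_apply (b : G.Edge) (x : Pt) (d e : I) :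
    pairRealiser ρ G C (.inl b) (x, ρ (d, e)) =
      ((G.realiser b (x, d)).1, ρ ((G.realiser b (x, d)).2, e)) :=
  liftMap_splitL_apply _ _ _ _

lemma pairRealiser_inr_apply (b : C.Edge) (x : Pt) (d e : I) :
    pairRealiser ρ G C (.inr b) (x, ρ (d, e)) =
      ((C.realiser b (x, e)).1, ρ (d, (C.realiser b (x, e)).2)) :=
  liftMap_splitR_apply _ _ _ _

lemma exists_eq_mk (p : Pt × I) : ∃ x d e, p = (x, ρ (d, e)) := by
  obtain ⟨d, e, h⟩ := exists_eq_apply_pair (ρ := ρ) p.2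
  exact ⟨p.1, d, e, Prod.ext rfl h⟩

lemma exists_eq_mk₃ (p : Pt × I) : ∃ x b d e, p = (x, ρ (b, ρ (d, e))) := by
  obtain ⟨x, b, f, rfl⟩ := exists_eq_mk (ρ := ρ) p
  obtain ⟨d, e, rfl⟩ := exists_eq_apply_pair (ρ := ρ) f
  exact ⟨x, b, d, e, rfl⟩

lemma InMicrocosm.relocate (hG : G.support = U) (h : G.InMicrocosm ρ) (hBρ : Microcosm ρ B) :
    (relocate ρ G B hW hB hG).InMicrocosm ρ := fun e =>
  .comp hBρ.liftMap_splitL.symm (.comp (h e).liftMap_splitR hBρ.liftMap_splitL)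

/-- Conjugating both graphings by `B` changes no circuit: transporting `G` forward to meet `C`
amounts to transporting `C` back to meet `G`. -/
theorem meas_exec_fax [Monoid Ω] (m : Ω → ℝ≥0∞) (hρ : MeasurePreserving ρ volume volume)
    (hBm : MeasurePreserving B muXI muXI) (hBρ : Microcosm ρ B) (hd : Disjoint U W)
    (hG : G.support = U) (hGρ : G.InMicrocosm ρ) (hC : C.support = W) (hCρ : C.InMicrocosm ρ) :
    meas ρ m (exec ρ (fax B hU hW hB) G) C =
      meas ρ m G (relocate ρ C B.symm hU (mem_iff_symm hB) hC) := by
  set C' := relocate ρ C B.symm hU (mem_iff_symm hB) hC with hC'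
  -- On the side of `G` the dialect is `ρ (b, ρ (d, c))`, with `b` for `G`, `d` for `B` and `c` for
  -- `C`. On the side of the execution it is bracketed as `ρ (ρ (d, b), c)`, so `T` applies `B` to
  -- place and `d`, then reassociates.
  set T : Pt × I ≃ᵐ Pt × I := (liftMap (splitR ρ) (liftMap (splitL ρ) B)).trans
    ((MeasurableEquiv.refl Pt).prodCongr (reassoc ρ)) with hT
  have hTa x b d c : T (x, ρ (b, ρ (d, c))) = ((B (x, d)).1, ρ (ρ ((B (x, d)).2, b), c)) := by
    change ((liftMap (splitR ρ) (liftMap (splitL ρ) B) (x, ρ (b, ρ (d, c)))).1,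
      reassoc ρ (liftMap (splitR ρ) (liftMap (splitL ρ) B) (x, ρ (b, ρ (d, c)))).2) = _
    rw [liftMap_splitR_apply, liftMap_splitL_apply, reassoc_apply]
  have hTm : MeasurePreserving T muXI muXI :=
    (measurePreserving_prodMap (MeasurePreserving.id muX) (measurePreserving_reassoc hρ)).comp
      (measurePreserving_liftMap (measurePreserving_splitR hρ)
        (measurePreserving_liftMap (measurePreserving_splitL hρ) hBm))
  let f : (exec ρ (fax B hU hW hB) G).Edge → G.Edge := fun π => ((execFaxEdge hd hG).symm π).1
  have hf : f.Injective := Subtype.val_injective.comp (Equiv.injective _)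
  have hfe b : f (execFaxEdge hd hG b) = b.1 :=
    congrArg Subtype.val (Equiv.symm_apply_apply (execFaxEdge hd hG) b)
  let g : C.Edge → C'.Edge := id
  have key : Factors ρ (F := G) (G := C') (F' := exec ρ (fax B hU hW hB) G) (G' := C) f g T
      (fun _ => ()) := by
    refine ⟨?_, ?_, fun _ _ => rfl, ?_, fun p q h _ => T.injective h⟩
    · rintro (π | c) p
      · obtain ⟨b, rfl⟩ := (execFaxEdge hd hG).surjective π
        obtain ⟨x, b', d, c, rfl⟩ := exists_eq_mk₃ (ρ := ρ) p
        rw [hTa, mem_pairSource_inl, source_execFaxEdge, mem_source_relocate, Sum.map_inl, hfe,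
          mem_pairSource_inl]
        simp
      · obtain ⟨x, b', d, c', rfl⟩ := exists_eq_mk₃ (ρ := ρ) p
        rw [hTa, mem_pairSource_inr, Sum.map_inr, mem_pairSource_inr, mem_source_relocate]
        rfl
    · rintro (π | c) p
      · obtain ⟨b, rfl⟩ := (execFaxEdge hd hG).surjective π
        obtain ⟨x, b', d, c, rfl⟩ := exists_eq_mk₃ (ρ := ρ) p
        rw [hTa, pairRealiser_inl_apply, realiser_execFaxEdge, realiser_relocate_apply,
          Sum.map_inl, hfe, pairRealiser_inl_apply, hTa, liftMap_splitL_apply]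
        simp
      · obtain ⟨x, b', d, c', rfl⟩ := exists_eq_mk₃ (ρ := ρ) p
        rw [hTa, pairRealiser_inr_apply, Sum.map_inr, pairRealiser_inr_apply,
          realiser_relocate_apply, liftMap_splitL_apply, hTa]
        simp
    · rintro (π | c)
      · obtain ⟨b, rfl⟩ := (execFaxEdge hd hG).surjective π
        exact (congrArg G.weight (hfe b)).trans (weight_execFaxEdge hd hG b).symm
      · rfl
  refine (key.meas hTm hf Function.injective_id fun π ⟨e, he, hr⟩ => ?_).symm
  -- Edges of `G` with negligible source have no counterpart in the execution, which keeps only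
  -- non-negligible paths.
  refine pathSource_null (fun e => (microcosm_pairRealiser hGρ
    (hCρ.relocate hC hBρ.symm) e).quasiMeasurePreserving hρ) ?_ he
  rcases e with b | c
  · have hb : muXI (G.source b) = 0 := by
      by_contra h
      rw [← measure_relocate_source (hW := hW) (hB := hB) hρ hBm hG] at h
      exact hr ⟨.inl (execFaxEdge hd hG ⟨b, h⟩), congrArg Sum.inl (hfe _)⟩
    exact ((measurePreserving_fst.comp (measurePreserving_splitL hρ)).measure_preimage
      (G.measurableSet_source b).nullMeasurableSet).trans hb
  · exact absurd ⟨.inr c, rfl⟩ hr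

lemma mem_source_bang {b : G.bang.Edge} {q : Pt × I} {w e : I} :
    (push2 (q, w), e) ∈ G.bang.source b ↔ q ∈ G.source b := by
  change (push2.symm (push2 (q, w))).1 ∈ G.source b ↔ _
  rw [push2.symm_apply_apply]

lemma realiser_bang_apply (b : G.bang.Edge) (q : Pt × I) (w e : I) :
    G.bang.realiser b (push2 (q, w), e) = (push2 (G.realiser b q, w), e) := by
  change (push2 (G.realiser b (push2.symm (push2 (q, w))).1, (push2.symm (push2 (q, w))).2), e) = _
  rw [push2.symm_apply_apply]

/-- After `B` the graphing `C` acts on the place and on its own dialect only, while `!G` acts on the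
place and the stored dialect. Forgetting the untouched slots leaves the pair `C`, `θ(G)`. -/
theorem meas_relocate_bang [Monoid Ω] (m : Ω → ℝ≥0∞) (hρ : MeasurePreserving ρ volume volume)
    {θ : Pt ≃ᵐ Pt} (hθ : MeasurePreserving θ muX muX)
    (hB : ∀ p, p.1 ∈ W ↔ ((raiseTo ρ θ).symm p).1 ∈ U) (hC : C.support = W) :
    meas ρ m (relocate ρ C (raiseTo ρ θ).symm hU hB hC) G.bang = meas ρ m C (G.deloc θ) := by
  -- With `q = (x, d)`, `T` keeps the place `θ x`, the dialect `c` of `C` and the stored dialect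
  -- `d`. The rest, recorded by `z`, is idle: the fresh slot `w`, the dialect `e` of `B` and the
  -- dialect `a` of the bang.
  set T : Pt × I → Pt × I := fun p => (splitR ρ).symm (timesIdMap θ
    (push2.symm (splitL ρ (splitL ρ p).1).1.1).1, (splitL ρ (splitL ρ p).1).2) with hT
  have hTa q w e c a : T (push2 (q, w), ρ (ρ (e, c), a)) = (θ q.1, ρ (c, q.2)) := by
    simp only [hT, splitL_apply, splitR_symm_apply, ρ.symm_apply_apply, push2.symm_apply_apply]
    rfl
  let z : Pt × I → I × I × I := fun p => ((push2.symm p.1).2, (ρ.symm (ρ.symm p.2).1).1,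
    (ρ.symm p.2).2)
  have hza q w e c a : z (push2 (q, w), ρ (ρ (e, c), a)) = (w, e, a) := by
    simp [z]
  have hTm : MeasurePreserving T muXI muXI :=
    (measurePreserving_splitR hρ).symm.comp ((measurePreserving_prodMap
      ((measurePreserving_timesIdMap hθ).comp (measurePreserving_fst.comp
        (measurePreserving_push2_symm.comp measurePreserving_fst)))
      (MeasurePreserving.id volume)).comp ((measurePreserving_splitL hρ).comp
        (measurePreserving_fst.comp (measurePreserving_splitL hρ))))
  have hex p : ∃ q w e c a, p = (push2 (q, w), ρ (ρ (e, c), a)) := by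
    obtain ⟨x, f, a, rfl⟩ := exists_eq_mk (ρ := ρ) p
    obtain ⟨e, c, rfl⟩ := exists_eq_apply_pair (ρ := ρ) f
    obtain ⟨⟨q, w⟩, rfl⟩ := push2.surjective x
    exact ⟨q, w, e, c, a, rfl⟩
  let f : C.Edge → (relocate ρ C (raiseTo ρ θ).symm hU hB hC).Edge := id
  let g : (G.deloc θ).Edge → G.bang.Edge := id
  have key : Factors ρ (F := relocate ρ C (raiseTo ρ θ).symm hU hB hC) (G := G.bang) (F' := C)
      (G' := G.deloc θ) f g T z := by
    refine ⟨?_, ?_, ?_, ?_, ?_⟩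
    · rintro (b | b) p <;> obtain ⟨q, w, e, c, a, rfl⟩ := hex p
      · rw [hTa, Sum.map_inl, mem_pairSource_inl, mem_pairSource_inl, mem_source_relocate]
        rfl
      · rw [hTa, Sum.map_inr, mem_pairSource_inr, mem_pairSource_inr, mem_source_bang]
        change _ ↔ (θ.symm (θ q.1), q.2) ∈ G.source b
        rw [θ.symm_apply_apply]
        rfl
    · rintro (b | b) p <;> obtain ⟨q, w, e, c, a, rfl⟩ := hex p
      · rw [hTa, Sum.map_inl, pairRealiser_inl_apply, pairRealiser_inl_apply,
          realiser_relocate_apply, liftMap_splitL_apply, MeasurableEquiv.symm_symm,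
          raiseTo_apply_push2, raiseTo_symm_apply, hTa]
        simp
      · rw [hTa, Sum.map_inr, pairRealiser_inr_apply, pairRealiser_inr_apply,
          realiser_bang_apply, hTa]
        change _ = (θ (G.realiser b (θ.symm (θ q.1), q.2)).1,
          ρ (c, (G.realiser b (θ.symm (θ q.1), q.2)).2))
        rw [θ.symm_apply_apply]
        rfl
    · rintro (b | b) p <;> obtain ⟨q, w, e, c, a, rfl⟩ := hex p
      · rw [hza, Sum.map_inl, pairRealiser_inl_apply,
          realiser_relocate_apply, liftMap_splitL_apply, MeasurableEquiv.symm_symm,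
          raiseTo_apply_push2, raiseTo_symm_apply, hza]
      · rw [hza, Sum.map_inr, pairRealiser_inr_apply, realiser_bang_apply, hza]
    · rintro (b | b) <;> rfl
    · intro p p' h1 h2
      obtain ⟨q, w, e, c, a, rfl⟩ := hex p
      obtain ⟨q', w', e', c', a', rfl⟩ := hex p'
      rw [hTa, hTa] at h1
      rw [hza, hza] at h2
      simp only [Prod.mk.injEq, EmbeddingLike.apply_eq_iff_eq] at h1 h2
      obtain ⟨h1, rfl, h3⟩ := h1
      obtain ⟨rfl, rfl, rfl⟩ := h2
      rw [Prod.ext h1 h3]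
  refine key.meas hTm Function.injective_id Function.injective_id fun π ⟨e, he, hr⟩ => ?_
  refine absurd ⟨e, ?_⟩ hr
  rcases e with e | e <;> rfl

end Graphing

/-! ### Dereliction -/

namespace Graphing

variable {Ω : Type*} {ρ : I × I ≃ᵐ I} {G : Graphing Ω}

lemma aeEq_of_eq {F : Graphing Ω} (h : F.support = G.support) (ε : F.Edge ≃ G.Edge)
    (hw : ∀ b, F.weight b = G.weight (ε b)) (hs : ∀ b, F.source b = G.source (ε b))
    (hr : ∀ b p, F.realiser b p = G.realiser (ε b) p) : F.AEEq G :=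
  ⟨h, ε.subtypeEquiv fun b => by rw [hs b], fun b => ⟨hw b.1, (hs b.1).eventuallyEq,
    .of_forall fun p _ => hr b.1 p⟩⟩

/-- In the raised dialect `ρ (d, ρ (w, e))` the graphing acts on `d` alone; `ρ (w, e)` is the unused
component. -/
lemma raiseBang_aeEq_timesId : (G.raiseBang ρ).AEEq (G.timesId ρ) := by
  have hex (p : Pt × I) : ∃ x d w e, p = (x, ρ (d, ρ (w, e))) := exists_eq_mk₃ p
  have hr x d w e : (raise ρ).symm (x, ρ (d, ρ (w, e))) = (push2 ((x, d), w), e) := by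
    rw [MeasurableEquiv.symm_apply_eq]
    rfl
  refine aeEq_of_eq rfl (Equiv.refl G.Edge) (fun _ => rfl)
    (fun (b : G.bang.Edge) => ?_) fun (b : G.bang.Edge) p => ?_
  · ext p
    obtain ⟨x, d, w, e, rfl⟩ := hex p
    change (raise ρ).symm (x, ρ (d, ρ (w, e))) ∈ G.bang.source b ↔
      (splitL ρ (x, ρ (d, ρ (w, e)))).1 ∈ G.source b
    rw [hr, mem_source_bang, splitL_apply, ρ.symm_apply_apply]
  · obtain ⟨x, d, w, e, rfl⟩ := hex p
    change raise ρ (G.bang.realiser b ((raise ρ).symm (x, ρ (d, ρ (w, e))))) =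
      liftMap (splitL ρ) (G.realiser b) (x, ρ (d, ρ (w, e)))
    rw [hr, realiser_bang_apply, liftMap_splitL_apply]
    rfl

variable [Monoid Ω] {V : Set Pt} {θ : Pt ≃ᵐ Pt}

lemma exec_fax_bang_aeEq {hU : MeasurableSet (bangSupport V)} {hW : MeasurableSet (θ '' V)}
    (hd : Disjoint (bangSupport V) (θ '' V)) (hG : G.support = V) :
    (exec ρ (fax (raiseTo ρ θ) hU hW mem_bangSupport_iff_raiseTo) G.bang).AEEq
      (((G.raiseBang ρ).deloc θ).timesId ρ) := by
  have hG' : G.bang.support = bangSupport V := bangSupport_congr hG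
  refine aeEq_exec_fax hd hG' (congrArg (fun S => θ '' S) hG)
    (Equiv.refl G.Edge) (fun _ => rfl) (fun b => rfl)
    fun (b : G.bang.Edge) p => ?_
  -- Here `f` is the dialect of the fax, into which `raise` packs the old slots, and `c` is that of
  -- the bang, which stays idle.
  obtain ⟨x, f, c, rfl⟩ := exists_eq_mk (ρ := ρ) p
  obtain ⟨d, w, e, rfl⟩ : ∃ d w e, f = ρ (d, ρ (w, e)) := by
    obtain ⟨d, g, rfl⟩ := exists_eq_apply_pair (ρ := ρ) f
    obtain ⟨w, e, rfl⟩ := exists_eq_apply_pair (ρ := ρ) g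
    exact ⟨d, w, e, rfl⟩
  rw [realiser_relocate_apply hG', raiseTo_symm_apply, realiser_bang_apply, liftMap_splitL_apply]
  change _ = liftMap (splitL ρ) ((raiseTo ρ θ).symm.trans ((G.bang.realiser b).trans
    (raiseTo ρ θ))) (x, ρ (ρ (d, ρ (w, e)), c))
  rw [liftMap_splitL_apply, MeasurableEquiv.trans_apply, MeasurableEquiv.trans_apply,
    raiseTo_symm_apply, realiser_bang_apply]

end Graphing

/-! ### From graphings to projects -/

namespace Project

variable {Ω : Type*} {ρ : I × I ≃ᵐ I} {U W : Set Pt} {B : Pt × I ≃ᵐ Pt × I}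
  {hU : MeasurableSet U} {hW : MeasurableSet W} {hB : ∀ p, p.1 ∈ U ↔ (B p).1 ∈ W}

/-- The transport of a project of support `U` along `B`. -/
def relocate (ρ : I × I ≃ᵐ I) (c : Project Ω) (B : Pt × I ≃ᵐ Pt × I) (hW : MeasurableSet W)
    (hB : ∀ p, p.1 ∈ U ↔ (B p).1 ∈ W) (hc : c.support = U) : Project Ω where
  wager := c.wager
  support := W
  Index := c.Index
  coeff := c.coeff
  slice i := (c.slice i).relocate ρ B hW hB ((c.slice_support i).trans hc)
  slice_support _ := rfl

lemma InMicrocosm.relocate {c : Project Ω} (h : c.InMicrocosm ρ) (hBρ : Microcosm ρ B)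
    (hc : c.support = U) : (c.relocate ρ B hW hB hc).InMicrocosm ρ := fun i =>
  Graphing.InMicrocosm.relocate (hB := hB) ((c.slice_support i).trans hc) (h i) hBρ

variable [Monoid Ω]

/-- The balanced project whose graphing exchanges `U × [0,1]` and `W × [0,1]` along `B`. -/
def fax (B : Pt × I ≃ᵐ Pt × I) (hU : MeasurableSet U) (hW : MeasurableSet W)
    (hB : ∀ p, p.1 ∈ U ↔ (B p).1 ∈ W) : Project Ω where
  wager := 0
  support := U ∪ W
  Index := Unit
  coeff _ := 1
  slice _ := Graphing.fax B hU hW hB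
  slice_support _ := rfl

local notation "𝔽" => fax (Ω := Ω) B hU hW hB

lemma isWinning_fax (hd : Disjoint U W) : (𝔽).IsWinning := by
  refine ⟨⟨rfl, ⟨inferInstanceAs (Unique Unit)⟩, fun _ => rfl⟩, fun _ => ⟨fun e => ⟨!e, ?_, ?_⟩,
    fun e e' h => ?_⟩⟩
  · cases e
    · change U ×ˢ univ = B.symm '' (W ×ˢ univ)
      ext p
      rw [B.symm.image_eq_preimage_symm]
      simp [hB]
    · change W ×ˢ univ = B '' (U ×ˢ univ)
      ext p
      rw [B.image_eq_preimage_symm]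
      simp [Graphing.mem_iff_symm hB]
  · cases e <;> rfl
  · have hd' : Disjoint (U ×ˢ (univ : Set I)) (W ×ˢ univ) := hd.set_prod_left _ _
    cases e <;> cases e'
    · exact absurd rfl h
    · exact hd'.symm
    · exact hd'
    · exact absurd rfl h

lemma inMicrocosm_fax (hBρ : Microcosm ρ B) : (𝔽).InMicrocosm ρ := fun _ e => by
  cases e
  · exact hBρ.symm
  · exact hBρ

lemma InMicrocosm.exec {m : Ω → ℝ≥0∞} {a b : Project Ω} (ha : a.InMicrocosm ρ)
    (hb : b.InMicrocosm ρ) : (exec ρ m a b).InMicrocosm ρ := fun i π =>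
  microcosm_pathRealiser (microcosm_pairRealiser (ha i.1) (hb i.2)) π.1

/-- The fax has wager `0` and total `1` and forms no circuit with `b`, so only the wager of `b`
survives; in particular the execution is always a project. -/
lemma pairing_fax (m : Ω → ℝ≥0∞) (hd : Disjoint U W) {b : Project Ω} (hb : b.support = U) :
    pairing ρ m 𝔽 b = b.wager := by
  have h i j : Graphing.meas ρ m ((𝔽).slice i) (b.slice j) = 0 :=
    Graphing.meas_fax (hU := hU) (hW := hW) (hB := hB) m hd ((b.slice_support j).trans hb)
  have h1 : (𝔽).total = 1 := Finset.sum_singleton _ _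
  have h0 : (𝔽).wager = 0 := rfl
  simp [pairing, h, h1, h0]

lemma pairing_exec_fax (m : Ω → ℝ≥0∞) (hρ : MeasurePreserving ρ volume volume)
    (hBm : MeasurePreserving B muXI muXI) (hBρ : Microcosm ρ B) (hd : Disjoint U W)
    {b c : Project Ω} (hb : b.support = U) (hbρ : b.InMicrocosm ρ) (hc : c.support = W)
    (hcρ : c.InMicrocosm ρ) :
    pairing ρ m (exec ρ m 𝔽 b) c =
      pairing ρ m b (c.relocate ρ B.symm hU (Graphing.mem_iff_symm hB) hc) := by
  have hw : (exec ρ m 𝔽 b).wager = b.wager := by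
    change (pairing ρ m 𝔽 b).toENNReal = _
    rw [pairing_fax m hd hb, EReal.toENNReal_coe]
  have ht : (exec ρ m 𝔽 b).total = b.total := by
    change ∑ i : Unit × b.Index, 1 * b.coeff i.2 = ∑ j, b.coeff j
    simp [Fintype.sum_prod_type]
  unfold pairing
  rw [hw, ht]
  congr 1
  change ∑ i : Unit × b.Index, ∑ j, ((1 * b.coeff i.2 * c.coeff j : ℝ) : EReal) *
    ((Graphing.meas ρ m (Graphing.exec ρ (Graphing.fax B hU hW hB) (b.slice i.2)) (c.slice j) :
      ℝ≥0∞) : EReal) = _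
  rw [Fintype.sum_prod_type, Fintype.sum_unique]
  refine Finset.sum_congr rfl fun i _ => Finset.sum_congr rfl fun j _ => ?_
  rw [Graphing.meas_exec_fax m hρ hBm hBρ hd ((b.slice_support i).trans hb) (hbρ i)
    ((c.slice_support j).trans hc) (hcρ j), one_mul]
  rfl

lemma pairing_relocate_bang (m : Ω → ℝ≥0∞) (hρ : MeasurePreserving ρ volume volume)
    {θ : Pt ≃ᵐ Pt} (hθ : MeasurePreserving θ muX muX)
    (hB : ∀ p, p.1 ∈ W ↔ ((raiseTo ρ θ).symm p).1 ∈ U) {a c : Project Ω} (hc : c.support = W) :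
    pairing ρ m (c.relocate ρ (raiseTo ρ θ).symm hU hB hc) a.bang =
      pairing ρ m c (a.deloc θ) := by
  unfold pairing
  congr 1
  refine Finset.sum_congr rfl fun i _ => Finset.sum_congr rfl fun j _ => ?_
  congr 2
  exact Graphing.meas_relocate_bang m hρ hθ hB ((c.slice_support i).trans hc)

end Project

/-! ### The fax maps `!A` into `θ(A)` -/

section

variable {Ω : Type*} [Monoid Ω] {m : Ω → ℝ≥0∞} {ρ : I × I ≃ᵐ I}

lemma exec_fax_mem_delocConduct (hρ : MeasurePreserving ρ volume volume)
    {V : Set Pt} {A : Set (Project Ω)} {θ : Pt ≃ᵐ Pt} (hθ : MeasurePreserving θ muX muX)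
    (hθρ : Microcosm ρ (timesIdMap θ)) (hV : Disjoint (bangSupport V) (θ '' V))
    (hU : MeasurableSet (bangSupport V)) (hW : MeasurableSet (θ '' V)) {b : Project Ω}
    (hb : b ∈ bangConduct ρ m V A) :
    Project.exec ρ m
      (Project.fax (raiseTo ρ θ) hU hW mem_bangSupport_iff_raiseTo) b ∈ delocConduct ρ m θ V A := by
  obtain ⟨hbρ, hbs, hbo⟩ := hb
  have hBρ : Microcosm ρ (raiseTo ρ θ) := microcosm_raise.comp hθρ
  have hBm : MeasurePreserving (raiseTo ρ θ) muXI muXI :=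
    (measurePreserving_timesIdMap hθ).comp (measurePreserving_raise hρ)
  have hs : (Project.exec ρ m
      (Project.fax (raiseTo ρ θ) hU hW mem_bangSupport_iff_raiseTo) b).support = θ '' V := by
    change symmDiff (bangSupport V ∪ θ '' V) b.support = _
    rw [hbs]
    exact symmDiff_union_self_left hV
  refine ⟨(Project.inMicrocosm_fax hBρ).exec hbρ, hs, fun c ⟨hcρ, hcs, hco⟩ => ?_⟩
  refine ⟨hs.trans hcs.symm, ?_⟩
  rw [Project.pairing_exec_fax m hρ hBm hBρ hV hbs hbρ hcs hcρ]
  -- As `b` is in a bi-orthogonal, it suffices that the transported test `B⁻¹(c)` be orthogonal to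
  -- the generators `!a`.
  refine (hbo (c.relocate ρ (raiseTo ρ θ).symm hU
    (Graphing.mem_iff_symm mem_bangSupport_iff_raiseTo) hcs)
    ⟨hcρ.relocate hBρ.symm hcs, rfl, ?_⟩).2
  rintro _ ⟨a, haA, -, rfl⟩
  have h := hco _ ⟨a, haA, rfl⟩
  refine ⟨?_, ?_⟩
  -- Orthogonality of `c` and `θ(a)` includes equality of supports, from which the support of `a` is
  -- recovered by injectivity of `θ`.
  · have : θ '' V = θ '' a.support := hcs.symm.trans h.1
    exact bangSupport_congr (θ.injective.image_injective this)
  · rw [Project.pairing_relocate_bang m hρ hθ]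
    exact h.2

end

end InteractionGraphs

theorem mainTheorem4 {Ω : Type*} [Monoid Ω] (m : Ω → ℝ≥0∞)
    (ρ : I × I ≃ᵐ I) (hρ : MeasurePreserving ρ volume volume)
    (V : Set Pt) (A : Set (Project Ω)) (hA : IsConduct ρ m V A)
    (θ : Pt ≃ᵐ Pt) (hθ : MeasurePreserving θ muX muX) (hθρ : Microcosm ρ (timesIdMap θ))
    (hV : Disjoint (bangSupport V) (θ '' V)) :
    Microcosm ρ (raise ρ) ∧
    ∃ der : Project Ω, der.IsWinning ∧
      der ∈ linImp ρ m (bangSupport V) (θ '' V) (bangConduct ρ m V A) (delocConduct ρ m θ V A) ∧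
      ∀ a ∈ A, a.IsBalanced →
        (Project.exec ρ m der a.bang).wager = 0 ∧
        (Project.exec ρ m der a.bang).AEEq (((a.raiseBang ρ).deloc θ).timesId ρ) ∧
        (a.raiseBang ρ).AEEq (a.timesId ρ) := by
  have hU : MeasurableSet (bangSupport V) := hA.1.bangSupport
  have hW : MeasurableSet (θ '' V) := θ.measurableSet_image.2 hA.1
  refine ⟨microcosm_raise, Project.fax (raiseTo ρ θ) hU hW mem_bangSupport_iff_raiseTo,
    Project.isWinning_fax hV, ⟨Project.inMicrocosm_fax (microcosm_raise.comp hθρ), rfl,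
      fun b hb => ⟨?_, exec_fax_mem_delocConduct hρ hθ hθρ hV hU hW hb⟩⟩, fun a ha hab => ?_⟩
  · rw [Project.pairing_fax m hV hb.2.1]
    exact EReal.coe_ennreal_nonneg _
  -- Being a polar, the conduct contains only projects of support `V`.
  · rw [hA.2] at ha
    have has : a.support = V := ha.2.1
    have hw : (Project.exec ρ m (Project.fax (raiseTo ρ θ) hU hW mem_bangSupport_iff_raiseTo)
        a.bang).wager = 0 := by
      change (Project.pairing ρ m _ a.bang).toENNReal = 0
      rw [Project.pairing_fax m hV (bangSupport_congr has), EReal.toENNReal_coe]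
      exact hab.1
    refine ⟨hw, ⟨hw.trans hab.1.symm, ?_, Equiv.punitProd a.Index, fun i => ⟨one_mul _,
      Graphing.exec_fax_bang_aeEq (hU := hU) (hW := hW) hV ((a.slice_support i.2).trans has)⟩⟩,
      rfl, rfl, Equiv.refl _, fun i => ⟨rfl, Graphing.raiseBang_aeEq_timesId⟩⟩
    change symmDiff (bangSupport V ∪ θ '' V) (bangSupport a.support) = θ '' a.support
    rw [has]
    exact symmDiff_union_self_left hV
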